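/- Let $K$ be an algebraically closed field and let $C$ be a $K$-coalgebra with comultiplication $\Delta(x)=\sum x_1\otimes x_2$ and counit $\epsilon$. Let $C^*=\mathrm{Hom}_K(C,K)$ be the dual algebra with the convolution product $(f*g)(x)=\sum f(x_1)g(x_2)$, let $e\in C^*$ be an idempotent, and write $e x=\sum x_1e(x_2)$ and $x e=\sum e(x_1)x_2$ for $x\in C$. The localized coalgebra $eCe=\{exe : x\in C\}$ has comultiplication $exe\mapsto\sum ex_1e\otimes ex_2e$ and, as counit, the restriction of $\epsilon$. The space $Ce$ is a left $eCe$-comodule by $y\mapsto\sum ey_1e\otimes y_2e$ and a right $C$-comodule by $y\mapsto\sum y_1\otimes y_2$; the section functor is the cotensor product functor $S=-\,\square_{eCe}\,Ce$ from right $eCe$-comodules to right $C$-comodules. Definitions. For a coalgebra $D$ over $K$, let $I_D$ be the set of isomorphism classes of simple right $D$-comodules and $K_0(D)\cong\mathbb{Z}^{(I_D)}$ the Grothendieck group. The length vector of a finite-dimensional right $D$-comodule $M$ is the vector in $\mathbb{Z}^{(I_D)}$ whose coordinate at $i$ is the number of composition factors of $M$ in the class $i$. For $v\in K_0(D)$ and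 $r\in\mathbb{N}$, say that $r$ bimodules suffice for $v$ if there are $K[t]$-$D$-bimodules $L^{(1)},\dots,L^{(r)}$ (right $D$-comodules with a compatible $K[t]$-module structure, for which the coaction is $K[t]$-linear), finitely generated and free over $K[t]$, such that, up to isomorphism, all but finitely many finite-dimensional indecomposable right $D$-comodules $M$ with length vector $v$ are of the form $M\cong K[t]/(t-\lambda)\otimes_{K[t]}L^{(s)}$ for some $s\le r$ and $\lambda\in K$. The coalgebra $D$ is of tame comodule type if for every $v\in K_0(D)$ there is an $r\in\mathbb{N}$ such that $r$ bimodules suffice for $v$. It is of discrete comodule type if it is of tame comodule type and for every $v\in K_0(D)$ the least such $r$ is $0$. Theorem. Assume that $S(N)$ is finite-dimensional over $K$ for every simple right $eCe$-comodule $N$. If $C$ is of tame comodule type, then $eCe$ is of tame comodule type. If $C$ is of discrete comodule type, then $eCe$ is of discrete comodule type. -/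

import Mathlib

open scoped TensorProduct Polynomial
open Coalgebra

universe u v w w'

noncomputable section

namespace CoalgLoc

/-! ### Right comodules -/

/-- A right comodule over the `K`-coalgebra `C`. -/
class RightComodule (K : Type u) (C : Type v) (M : Type w) [Field K] [AddCommGroup C] [Module K C]
    [Coalgebra K C] [AddCommGroup M] [Module K M] where
  /-- The coaction `M → M ⊗ C`. -/
  coact : M →ₗ[K] M ⊗[K] C
  coassoc : (TensorProduct.assoc K M C C).toLinearMap ∘ₗ coact.rTensor C ∘ₗ coact =
    (comul (R := K) (A := C)).lTensor M ∘ₗ coact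
  counit : (Coalgebra.counit (R := K) (A := C)).lTensor M ∘ₗ coact =
    (TensorProduct.mk K M K).flip 1

section Comodules

variable (K : Type u) (C : Type v) [Field K] [AddCommGroup C] [Module K C] [Coalgebra K C]

/-- The coaction of a right `C`-comodule `M`. -/
def coact (M : Type w) [AddCommGroup M] [Module K M] [RightComodule K C M] :
    M →ₗ[K] M ⊗[K] C :=
  RightComodule.coact

/-- `f` is a homomorphism of right `C`-comodules. -/
def IsComoduleHom {M : Type w} {N : Type w'} [AddCommGroup M] [Module K M] [RightComodule K C M]
    [AddCommGroup N] [Module K N] [RightComodule K C N] (f : M →ₗ[K] N) : Prop :=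
  coact K C N ∘ₗ f = f.rTensor C ∘ₗ coact K C M

/-- `P` is a subcomodule of `M`: the coaction sends `P` into (the image of) `P ⊗ C`. -/
def IsSubcomodule {M : Type w} [AddCommGroup M] [Module K M] [RightComodule K C M]
    (P : Submodule K M) : Prop :=
  ∀ x ∈ P, coact K C M x ∈ LinearMap.range (P.subtype.rTensor C)

/-- `M` and `N` are isomorphic right `C`-comodules. -/
def ComoduleIso (M : Type w) (N : Type w') [AddCommGroup M] [Module K M] [RightComodule K C M]
    [AddCommGroup N] [Module K N] [RightComodule K C N] : Prop :=
  ∃ f : M ≃ₗ[K] N, IsComoduleHom K C f.toLinearMap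

/-- A simple right comodule. -/
def IsSimpleComodule (M : Type w) [AddCommGroup M] [Module K M] [RightComodule K C M] : Prop :=
  Nontrivial M ∧ ∀ P : Submodule K M, IsSubcomodule K C P → P = ⊥ ∨ P = ⊤

/-- An indecomposable right comodule: nonzero and not a direct sum of two nonzero subcomodules. -/
def IsIndecomposableComodule (M : Type w) [AddCommGroup M] [Module K M] [RightComodule K C M] :
    Prop :=
  Nontrivial M ∧ ∀ P Q : Submodule K M, IsSubcomodule K C P → IsSubcomodule K C Q →
    IsCompl P Q → P = ⊥ ∨ Q = ⊥

section Sub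

variable {K C} {M : Type w} [AddCommGroup M] [Module K M] [RightComodule K C M]
  {P : Submodule K M} (hP : IsSubcomodule K C P)

theorem rTensor_subtype_injective (P : Submodule K M) (X : Type w') [AddCommGroup X] [Module K X] :
    Function.Injective (P.subtype.rTensor X) :=
  Module.Flat.rTensor_preserves_injective_linearMap _ P.injective_subtype

/-- The restriction of the coaction to a subcomodule. -/
def subCoact : P →ₗ[K] P ⊗[K] C :=
  LinearMap.codRestrictOfInjective (coact K C M ∘ₗ P.subtype) (P.subtype.rTensor C)
    (rTensor_subtype_injective P C) (fun x => hP x.1 x.2)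

theorem subtype_comp_subCoact :
    P.subtype.rTensor C ∘ₗ subCoact hP = coact K C M ∘ₗ P.subtype :=
  LinearMap.codRestrictOfInjective_comp _ _ _ _

theorem subtype_subCoact (x : P) : P.subtype.rTensor C (subCoact hP x) = coact K C M x :=
  LinearMap.congr_fun (subtype_comp_subCoact hP) x

/-- A subcomodule is a comodule, by restriction of the coaction. -/
@[reducible]
def subcomodule : RightComodule K C P where
  coact := subCoact hP
  coassoc := by
    apply LinearMap.ext
    intro x
    apply rTensor_subtype_injective P (C ⊗[K] C)
    have h1 : ∀ z : P ⊗[K] C, P.subtype.rTensor (C ⊗[K] C)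
        (TensorProduct.assoc K P C C ((subCoact hP).rTensor C z)) =
        TensorProduct.assoc K M C C ((coact K C M).rTensor C (P.subtype.rTensor C z)) := by
      intro z
      rw [← LinearMap.rTensor_comp_apply, ← subtype_comp_subCoact hP,
        LinearMap.rTensor_comp_apply]
      generalize (subCoact hP).rTensor C z = y
      induction y with
      | zero => simp
      | add a b ha hb => simp only [map_add, ha, hb]
      | tmul a c =>
        induction a with
        | zero => simp
        | add a b ha hb => simp only [map_add, TensorProduct.add_tmul, ha, hb]
        | tmul a d => simp
    have h2 : ∀ z : P ⊗[K] C, P.subtype.rTensor (C ⊗[K] C)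
        ((comul (R := K) (A := C)).lTensor P z) =
        (comul (R := K) (A := C)).lTensor M (P.subtype.rTensor C z) := by
      intro z
      induction z with
      | zero => simp
      | add a b ha hb => simp only [map_add, ha, hb]
      | tmul a c => simp
    have h3 := LinearMap.congr_fun (RightComodule.coassoc (K := K) (C := C) (M := M)) x
    simp only [LinearMap.comp_apply, LinearEquiv.coe_coe] at h3 ⊢
    rw [h1, h2, subtype_subCoact]
    exact h3
  counit := by
    apply LinearMap.ext
    intro x
    apply rTensor_subtype_injective P K
    have h2 : ∀ z : P ⊗[K] C, P.subtype.rTensor K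
        ((Coalgebra.counit (R := K) (A := C)).lTensor P z) =
        (Coalgebra.counit (R := K) (A := C)).lTensor M (P.subtype.rTensor C z) := by
      intro z
      induction z with
      | zero => simp
      | add a b ha hb => simp only [map_add, ha, hb]
      | tmul a c => simp
    have h3 := LinearMap.congr_fun (RightComodule.counit (K := K) (C := C) (M := M)) x
    simp only [LinearMap.comp_apply] at h3 ⊢
    rw [h2, subtype_subCoact]
    exact h3.trans (by simp)

/-- The locus where two comodule homomorphisms agree is a subcomodule. -/
theorem isSubcomodule_eqLocus {N : Type w'} [AddCommGroup N] [Module K N] [RightComodule K C N]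
    {f g : M →ₗ[K] N} (hf : IsComoduleHom K C f) (hg : IsComoduleHom K C g) :
    IsSubcomodule K C (LinearMap.eqLocus f g) := by
  rw [LinearMap.eqLocus_eq_ker_sub]
  have hd : IsComoduleHom K C (f - g) := by
    unfold IsComoduleHom at *
    rw [LinearMap.comp_sub, LinearMap.rTensor_sub, LinearMap.sub_comp, hf, hg]
  intro x hx
  have hex := Module.Flat.rTensor_exact C (LinearMap.exact_subtype_ker_map (f - g))
  refine (hex _).1 ?_
  have h := LinearMap.congr_fun hd x
  simp only [LinearMap.comp_apply] at h
  rw [← h, LinearMap.mem_ker.1 hx, map_zero]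

end Sub

/-- For a `K`-algebra `R`, the right `C`-comodule `L` with a left `R`-module structure is an
`R`-`C`-bimodule: the coaction `L → L ⊗ C` is `R`-linear. -/
class IsBimodule (R : Type w') (L : Type w) [CommRing R] [Algebra K R] [AddCommGroup L]
    [Module K L] [Module R L] [IsScalarTower K R L] [RightComodule K C L] : Prop where
  coact_smul : ∀ (r : R) (x : L), coact K C L (r • x) = r • coact K C L x

/-- Over the base field itself every comodule is a bimodule. -/
instance (L : Type w) [AddCommGroup L] [Module K L] [RightComodule K C L] :
    IsBimodule K C K L :=
  ⟨fun r x => map_smul (coact K C L) r x⟩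

section Tensor

variable (R : Type*) [CommRing R] [Algebra K R]
  (M : Type*) [AddCommGroup M] [Module K M] [Module R M] [IsScalarTower K R M]
  (L : Type*) [AddCommGroup L] [Module K L] [Module R L] [IsScalarTower K R L]
  [RightComodule K C L] [IsBimodule K C R L]

/-- The coaction of an `R`-`C`-bimodule as an `R`-linear map. -/
def coactLinear : L →ₗ[R] L ⊗[K] C where
  toFun := coact K C L
  map_add' := map_add _
  map_smul' := IsBimodule.coact_smul

/-- The coaction `m ⊗ l ↦ ∑ (m ⊗ l₀) ⊗ l₁` on `M ⊗[R] L`. -/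
def tensorCoact : M ⊗[R] L →ₗ[K] (M ⊗[R] L) ⊗[K] C :=
  ((TensorProduct.AlgebraTensorModule.assoc K R R M L C).symm.toLinearMap ∘ₗ
    (coactLinear K C R L).lTensor M).restrictScalars K

/-- The `K`-linear map `l ↦ m ⊗ l`. -/
def tmulLeft (m : M) : L →ₗ[K] M ⊗[R] L :=
  (TensorProduct.mk R M L m).restrictScalars K

theorem tensorCoact_tmul (m : M) (l : L) :
    tensorCoact K C R M L (m ⊗ₜ l) = (tmulLeft K R M L m).rTensor C (coact K C L l) := by
  have : ∀ z : L ⊗[K] C, (TensorProduct.AlgebraTensorModule.assoc K R R M L C).symm (m ⊗ₜ[R] z) =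
      (tmulLeft K R M L m).rTensor C z := by
    intro z
    induction z with
    | zero => simp
    | add a b ha hb => simp only [map_add, TensorProduct.tmul_add, ha, hb]
    | tmul a c => rfl
  exact this _

/-- For an `R`-module `M` and an `R`-`C`-bimodule `L`, the tensor product `M ⊗[R] L` is a right
`C`-comodule. -/
instance tensorComodule : RightComodule K C (M ⊗[R] L) where
  coact := tensorCoact K C R M L
  coassoc := by
    apply LinearMap.ext
    intro x
    induction x with
    | zero => simp
    | add a b ha hb => simp only [map_add, ha, hb]
    | tmul m l =>
      have hc : tensorCoact K C R M L ∘ₗ tmulLeft K R M L m =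
          (tmulLeft K R M L m).rTensor C ∘ₗ coact K C L :=
        LinearMap.ext fun l => tensorCoact_tmul K C R M L m l
      simp only [LinearMap.comp_apply, LinearEquiv.coe_coe, tensorCoact_tmul]
      rw [← LinearMap.rTensor_comp_apply, hc, LinearMap.rTensor_comp_apply]
      have h1 : ∀ z : (L ⊗[K] C) ⊗[K] C, TensorProduct.assoc K (M ⊗[R] L) C C
          (((tmulLeft K R M L m).rTensor C).rTensor C z) =
          (tmulLeft K R M L m).rTensor (C ⊗[K] C) (TensorProduct.assoc K L C C z) := by
        intro y
        induction y with
        | zero => simp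
        | add a b ha hb => simp only [map_add, ha, hb]
        | tmul a c =>
          induction a with
          | zero => simp
          | add a b ha hb => simp only [map_add, TensorProduct.add_tmul, ha, hb]
          | tmul a d => simp
      have h2 : ∀ z : L ⊗[K] C, (tmulLeft K R M L m).rTensor (C ⊗[K] C)
          ((comul (R := K) (A := C)).lTensor L z) =
          (comul (R := K) (A := C)).lTensor (M ⊗[R] L) ((tmulLeft K R M L m).rTensor C z) := by
        intro z
        induction z with
        | zero => simp
        | add a b ha hb => simp only [map_add, ha, hb]
        | tmul a c => simp
      have h3 := LinearMap.congr_fun (RightComodule.coassoc (K := K) (C := C) (M := L)) l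
      rw [h1, ← h2]
      exact congrArg _ h3
  counit := by
    apply LinearMap.ext
    intro x
    induction x with
    | zero => simp
    | add a b ha hb => simp only [map_add, ha, hb]
    | tmul m l =>
      simp only [LinearMap.comp_apply, tensorCoact_tmul]
      have h2 : ∀ z : L ⊗[K] C, (tmulLeft K R M L m).rTensor K
          ((Coalgebra.counit (R := K) (A := C)).lTensor L z) =
          (Coalgebra.counit (R := K) (A := C)).lTensor (M ⊗[R] L)
            ((tmulLeft K R M L m).rTensor C z) := by
        intro z
        induction z with
        | zero => simp
        | add a b ha hb => simp only [map_add, ha, hb]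
        | tmul a c => simp
      have h3 := LinearMap.congr_fun (RightComodule.counit (K := K) (C := C) (M := L)) l
      rw [← h2]
      refine (congrArg ((tmulLeft K R M L m).rTensor K) h3).trans ?_
      simp [tmulLeft]

end Tensor

/-- A bundled right `C`-comodule. -/
structure Comod where
  /-- The underlying type. -/
  carrier : Type w
  [addCommGroup : AddCommGroup carrier]
  [module : Module K carrier]
  [comodule : RightComodule K C carrier]

attribute [instance] Comod.addCommGroup Comod.module Comod.comodule

/-- A bundled `K[t]`-`C`-bimodule. -/
structure PolyBimodule where
  /-- The underlying type. -/
  carrier : Type w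
  [addCommGroup : AddCommGroup carrier]
  [module : Module K carrier]
  [polyModule : Module K[X] carrier]
  [tower : IsScalarTower K K[X] carrier]
  [comodule : RightComodule K C carrier]
  [bimodule : IsBimodule K C K[X] carrier]

attribute [instance] PolyBimodule.addCommGroup PolyBimodule.module PolyBimodule.polyModule
  PolyBimodule.tower PolyBimodule.comodule PolyBimodule.bimodule

end Comodules

/-! ### Length vectors and comodule types -/

section Types

variable (K C : Type u) [Field K] [AddCommGroup C] [Module K C] [Coalgebra K C]

/-- Isomorphism of simple right comodules. -/
def simpleSetoid : Setoid {S : Comod.{u, u, u} K C // IsSimpleComodule K C S.carrier} where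
  r S T := ComoduleIso K C S.1.carrier T.1.carrier
  iseqv :=
    { refl := fun S => ⟨LinearEquiv.refl K _, by simp [IsComoduleHom]⟩
      symm := by
        rintro S T ⟨f, hf⟩
        refine ⟨f.symm, ?_⟩
        have hc : f.symm.toLinearMap.rTensor C ∘ₗ f.toLinearMap.rTensor C = LinearMap.id := by
          rw [← LinearMap.rTensor_comp]; simp
        have hf' : coact K C _ ∘ₗ f.toLinearMap = f.toLinearMap.rTensor C ∘ₗ coact K C _ := hf
        apply LinearMap.ext
        intro y
        obtain ⟨x, rfl⟩ := f.surjective y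
        have h1 := LinearMap.congr_fun hf' x
        have h2 := LinearMap.congr_fun hc (coact K C _ x)
        simp only [LinearMap.comp_apply, LinearEquiv.coe_coe, LinearMap.id_apply,
          LinearEquiv.symm_apply_apply] at h1 h2 ⊢
        rw [h1, h2]
      trans := by
        rintro S T U ⟨f, hf⟩ ⟨g, hg⟩
        refine ⟨f.trans g, ?_⟩
        have hf' : coact K C _ ∘ₗ f.toLinearMap = f.toLinearMap.rTensor C ∘ₗ coact K C _ := hf
        have hg' : coact K C _ ∘ₗ g.toLinearMap = g.toLinearMap.rTensor C ∘ₗ coact K C _ := hg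
        change coact K C _ ∘ₗ g.toLinearMap ∘ₗ f.toLinearMap =
          (g.toLinearMap ∘ₗ f.toLinearMap).rTensor C ∘ₗ coact K C _
        rw [LinearMap.rTensor_comp, LinearMap.comp_assoc, ← hf', ← LinearMap.comp_assoc, hg',
          LinearMap.comp_assoc] }

/-- The set `I_C` of isomorphism classes of simple right `C`-comodules. -/
def SimpleClass : Type (u + 1) :=
  Quotient (simpleSetoid K C)

/-- The class of a simple comodule. -/
def SimpleClass.mk (S : Comod.{u, u, u} K C) (hS : IsSimpleComodule K C S.carrier) : SimpleClass K C :=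
  Quotient.mk (simpleSetoid K C) ⟨S, hS⟩

/-- The Grothendieck group `K₀(C)`, in its standard identification with `ℤ^(I_C)` through the
classes of the simple comodules. -/
abbrev GrothendieckGroup : Type (u + 1) := SimpleClass K C →₀ ℤ

variable {K C} in
/-- `HasLengthVector M v`: the comodule `M` has a composition series
`0 = M₀ ⊂ M₁ ⊂ ⋯ ⊂ Mₙ = M` in which, for each simple `S`, exactly `v S` of the composition factors
`Mᵢ / Mᵢ₋₁` are isomorphic to `S`. (By Jordan-Hölder there is at most one such `v`.) The series is
built from the bottom: the zero comodule has length vector `0`, and if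
`0 → M' → M → S → 0` is an exact sequence of comodules with `S` simple, then the length vector of
`M` is that of `M'` plus the unit vector at `S`. -/
inductive HasLengthVector : Comod.{u, u, u} K C → GrothendieckGroup K C → Prop
  | zero (M : Comod.{u, u, u} K C) (hM : Subsingleton M.carrier) : HasLengthVector M 0
  | step (M' M S : Comod.{u, u, u} K C) (hS : IsSimpleComodule K C S.carrier)
      (f : M'.carrier →ₗ[K] M.carrier) (g : M.carrier →ₗ[K] S.carrier)
      (hf : IsComoduleHom K C f) (hg : IsComoduleHom K C g)
      (f_inj : Function.Injective f) (g_surj : Function.Surjective g)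
      (exact : Function.Exact f g) (v : GrothendieckGroup K C) (hM' : HasLengthVector M' v) :
      HasLengthVector M (v + Finsupp.single (SimpleClass.mk K C S hS) 1)

/-- The one-dimensional `K[t]`-module `K[t] / (t - a)`. -/
abbrev pointModule (a : K) : Type u := K[X] ⧸ Ideal.span {(Polynomial.X - Polynomial.C a : K[X])}

/-- `TameWith K C v r`: there are `r` bimodules `L 0, …, L (r - 1)` over `K[t]` and `C`, finitely
generated and free over `K[t]`, such that, up to isomorphism, all but finitely many (namely the
`E j`) of the finite-dimensional indecomposable right `C`-comodules with length vector `v` are of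
the form `K[t] / (t - a) ⊗ L s`. -/
def TameWith (v : GrothendieckGroup K C) (r : ℕ) : Prop :=
  ∃ L : Fin r → PolyBimodule.{u, u, u} K C,
    (∀ s, Module.Finite K[X] (L s).carrier ∧ Module.Free K[X] (L s).carrier) ∧
    ∃ (n : ℕ) (E : Fin n → Comod.{u, u, u} K C), ∀ M : Comod.{u, u, u} K C,
      FiniteDimensional K M.carrier → IsIndecomposableComodule K C M.carrier →
      HasLengthVector M v →
      (∃ j, ComoduleIso K C M.carrier (E j).carrier) ∨
      ∃ (s : Fin r) (a : K), ComoduleIso K C M.carrier (pointModule K a ⊗[K[X]] (L s).carrier)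

/-- Tame comodule type. -/
def IsTame : Prop :=
  ∀ v : GrothendieckGroup K C, ∃ r : ℕ, TameWith K C v r

/-- The growth function `μ¹`: the minimal number of bimodules needed for `v`. -/
def growth (v : GrothendieckGroup K C) : ℕ :=
  sInf {r | TameWith K C v r}

/-- Discrete comodule type: tame, with vanishing growth function. -/
def IsDiscrete : Prop :=
  IsTame K C ∧ ∀ v : GrothendieckGroup K C, growth K C v = 0

end Types

/-! ### The localized coalgebra and the section functor -/

section Localization

variable {K : Type u} {C : Type v} [Field K] [AddCommGroup C] [Module K C] [Coalgebra K C]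

/-- `x ↦ e x = ∑ x₁ e(x₂)`. -/
def actL (e : WithConv (C →ₗ[K] K)) : C →ₗ[K] C :=
  (TensorProduct.rid K C).toLinearMap ∘ₗ e.ofConv.lTensor C ∘ₗ comul

/-- `x ↦ x e = ∑ e(x₁) x₂`. -/
def actR (e : WithConv (C →ₗ[K] K)) : C →ₗ[K] C :=
  (TensorProduct.lid K C).toLinearMap ∘ₗ e.ofConv.rTensor C ∘ₗ comul

variable (e : WithConv (C →ₗ[K] K))

/-- The space `eCe`, for an idempotent `e` of the dual algebra `C*` (with the convolution
product). -/
def Localized (_he : IsIdempotentElem e) : Type v :=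
  LinearMap.range (actL e ∘ₗ actR e)

/-- The space `Ce`. -/
def RightPart (_he : IsIdempotentElem e) : Type v :=
  LinearMap.range (actR e)

variable (he : IsIdempotentElem e)

instance : AddCommGroup (Localized e he) :=
  inferInstanceAs (AddCommGroup (LinearMap.range (actL e ∘ₗ actR e)))

instance : Module K (Localized e he) :=
  inferInstanceAs (Module K (LinearMap.range (actL e ∘ₗ actR e)))

instance : AddCommGroup (RightPart e he) :=
  inferInstanceAs (AddCommGroup (LinearMap.range (actR e)))

instance : Module K (RightPart e he) :=
  inferInstanceAs (Module K (LinearMap.range (actR e)))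

/-- The inclusion `eCe ⊆ C`. -/
def Localized.incl : Localized e he →ₗ[K] C :=
  (LinearMap.range (actL e ∘ₗ actR e)).subtype

/-- The map `C → eCe`, `x ↦ e x e`. -/
def Localized.proj : C →ₗ[K] Localized e he :=
  (actL e ∘ₗ actR e).rangeRestrict

/-- The inclusion `Ce ⊆ C`. -/
def RightPart.incl : RightPart e he →ₗ[K] C :=
  (LinearMap.range (actR e)).subtype

/-- The map `C → Ce`, `x ↦ x e`. -/
def RightPart.proj : C →ₗ[K] RightPart e he :=
  (actR e).rangeRestrict

theorem Localized.incl_proj (x : C) : Localized.incl e he (Localized.proj e he x) =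
    actL e (actR e x) :=
  rfl

theorem RightPart.incl_proj (x : C) : RightPart.incl e he (RightPart.proj e he x) = actR e x :=
  rfl

theorem Localized.incl_injective : Function.Injective (Localized.incl e he) :=
  Subtype.val_injective

theorem RightPart.incl_injective : Function.Injective (RightPart.incl e he) :=
  Subtype.val_injective

theorem Localized.proj_surjective : Function.Surjective (Localized.proj e he) :=
  LinearMap.surjective_rangeRestrict _

theorem RightPart.proj_surjective : Function.Surjective (RightPart.proj e he) :=
  LinearMap.surjective_rangeRestrict _

theorem comul_actR (x : C) :
    comul (R := K) (actR e x) = (actR e).rTensor C (comul (R := K) x) := by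
  have h : ∀ z : C ⊗[K] C, comul (R := K) (TensorProduct.lid K C (e.ofConv.rTensor C z)) =
      ((TensorProduct.lid K C).toLinearMap ∘ₗ e.ofConv.rTensor C).rTensor C
        ((TensorProduct.assoc K C C C).symm ((comul (R := K) (A := C)).lTensor C z)) := by
    intro z
    induction z with
    | zero => simp
    | add a b ha hb => simp only [map_add, ha, hb]
    | tmul a b =>
      simp only [LinearMap.rTensor_tmul, LinearMap.lTensor_tmul, TensorProduct.lid_tmul, map_smul]
      generalize comul (R := K) b = y
      induction y with
      | zero => simp
      | add c d hc hd => simp only [map_add, TensorProduct.tmul_add, smul_add, hc, hd]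
      | tmul c d => simp [TensorProduct.smul_tmul']
  have h' := h (comul (R := K) x)
  rw [coassoc_symm_apply, ← LinearMap.rTensor_comp_apply] at h'
  exact h'

theorem comul_actL (x : C) :
    comul (R := K) (actL e x) = (actL e).lTensor C (comul (R := K) x) := by
  have h : ∀ z : C ⊗[K] C, comul (R := K) (TensorProduct.rid K C (e.ofConv.lTensor C z)) =
      ((TensorProduct.rid K C).toLinearMap ∘ₗ e.ofConv.lTensor C).lTensor C
        (TensorProduct.assoc K C C C ((comul (R := K) (A := C)).rTensor C z)) := by
    intro z
    induction z with
    | zero => simp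
    | add a b ha hb => simp only [map_add, ha, hb]
    | tmul a b =>
      simp only [LinearMap.rTensor_tmul, LinearMap.lTensor_tmul, TensorProduct.rid_tmul, map_smul]
      generalize comul (R := K) a = y
      induction y with
      | zero => simp
      | add c d hc hd => simp only [map_add, TensorProduct.add_tmul, smul_add, hc, hd]
      | tmul c d => simp
  have h' := h (comul (R := K) x)
  rw [coassoc_apply, ← LinearMap.lTensor_comp_apply] at h'
  exact h'

theorem actL_actR (x : C) : actL e (actR e x) = actR e (actL e x) := by
  have h : ∀ z : C ⊗[K] C, TensorProduct.rid K C (e.ofConv.lTensor C ((actR e).rTensor C z)) =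
      actR e (TensorProduct.rid K C (e.ofConv.lTensor C z)) := by
    intro z
    induction z with
    | zero => simp
    | add a b ha hb => simp only [map_add, ha, hb]
    | tmul a b => simp
  have h' := h (comul (R := K) x)
  rw [← comul_actR] at h'
  exact h'

theorem counit_actR (x : C) : Coalgebra.counit (R := K) (actR e x) = e.ofConv x := by
  have h : ∀ z : C ⊗[K] C, Coalgebra.counit (R := K) (TensorProduct.lid K C
      (e.ofConv.rTensor C z)) =
      e.ofConv (TensorProduct.rid K C ((Coalgebra.counit (R := K) (A := C)).lTensor C z)) := by
    intro z
    induction z with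
    | zero => simp
    | add a b ha hb => simp only [map_add, ha, hb]
    | tmul a b => simp [mul_comm]
  have h' := h (comul (R := K) x)
  rw [lTensor_counit_comul, TensorProduct.rid_tmul, one_smul] at h'
  exact h'

theorem counit_actL (x : C) : Coalgebra.counit (R := K) (actL e x) = e.ofConv x := by
  have h : ∀ z : C ⊗[K] C, Coalgebra.counit (R := K) (TensorProduct.rid K C
      (e.ofConv.lTensor C z)) =
      e.ofConv (TensorProduct.lid K C ((Coalgebra.counit (R := K) (A := C)).rTensor C z)) := by
    intro z
    induction z with
    | zero => simp
    | add a b ha hb => simp only [map_add, ha, hb]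
    | tmul a b => simp [mul_comm]
  have h' := h (comul (R := K) x)
  rw [rTensor_counit_comul, TensorProduct.lid_tmul, one_smul] at h'
  exact h'

theorem apply_actR (hi : IsIdempotentElem e) (x : C) : e.ofConv (actR e x) = e.ofConv x := by
  have h : ∀ z : C ⊗[K] C, e.ofConv (TensorProduct.lid K C (e.ofConv.rTensor C z)) =
      LinearMap.mul' K K (TensorProduct.map e.ofConv e.ofConv z) := by
    intro z
    induction z with
    | zero => simp
    | add a b ha hb => simp only [map_add, ha, hb]
    | tmul a b => simp
  have h' := h (comul (R := K) x)
  have h2 : (e * e).ofConv x = e.ofConv x := by rw [hi.eq]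
  exact h'.trans h2

theorem apply_actL (hi : IsIdempotentElem e) (x : C) : e.ofConv (actL e x) = e.ofConv x := by
  rw [← counit_actR, ← actL_actR, counit_actL, apply_actR e hi]

theorem actR_actR (hi : IsIdempotentElem e) (x : C) : actR e (actR e x) = actR e x := by
  have h : e.ofConv ∘ₗ actR e = e.ofConv := LinearMap.ext (apply_actR e hi)
  change TensorProduct.lid K C (e.ofConv.rTensor C (comul (R := K) (actR e x))) = _
  rw [comul_actR, ← LinearMap.rTensor_comp_apply, h]
  rfl

theorem actL_actL (hi : IsIdempotentElem e) (x : C) : actL e (actL e x) = actL e x := by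
  have h : e.ofConv ∘ₗ actL e = e.ofConv := LinearMap.ext (apply_actL e hi)
  change TensorProduct.rid K C (e.ofConv.lTensor C (comul (R := K) (actL e x))) = _
  rw [comul_actL, ← LinearMap.lTensor_comp_apply, h]
  rfl

theorem Localized.proj_actR : Localized.proj e he ∘ₗ actR e = Localized.proj e he := by
  apply LinearMap.ext
  intro x
  apply Localized.incl_injective
  rw [LinearMap.comp_apply, Localized.incl_proj, Localized.incl_proj, actR_actR e he]

theorem Localized.proj_actL : Localized.proj e he ∘ₗ actL e = Localized.proj e he := by
  apply LinearMap.ext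
  intro x
  apply Localized.incl_injective
  rw [LinearMap.comp_apply, Localized.incl_proj, Localized.incl_proj, ← actL_actR,
    actL_actL e he]

theorem RightPart.proj_actR : RightPart.proj e he ∘ₗ actR e = RightPart.proj e he := by
  apply LinearMap.ext
  intro x
  apply RightPart.incl_injective
  rw [LinearMap.comp_apply, RightPart.incl_proj, RightPart.incl_proj, actR_actR e he]

/-- The comultiplication `y ↦ ∑ e y₁ e ⊗ e y₂ e` of `eCe`. -/
def Localized.comul : Localized e he →ₗ[K] Localized e he ⊗[K] Localized e he :=
  TensorProduct.map (Localized.proj e he) (Localized.proj e he) ∘ₗ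
    Coalgebra.comul ∘ₗ Localized.incl e he

theorem Localized.comul_proj : Localized.comul e he ∘ₗ Localized.proj e he =
    TensorProduct.map (Localized.proj e he) (Localized.proj e he) ∘ₗ Coalgebra.comul := by
  apply LinearMap.ext
  intro x
  simp only [Localized.comul, LinearMap.comp_apply, Localized.incl_proj]
  rw [comul_actL, comul_actR, LinearMap.lTensor, LinearMap.rTensor,
    ← LinearMap.comp_apply, ← LinearMap.comp_apply, ← TensorProduct.map_comp,
    LinearMap.comp_id, Localized.proj_actL, ← TensorProduct.map_comp, Localized.proj_actR,
    LinearMap.comp_id]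

theorem Localized.counit_proj : (Coalgebra.counit ∘ₗ Localized.incl e he) ∘ₗ Localized.proj e he =
    e.ofConv := by
  apply LinearMap.ext
  intro x
  simp only [LinearMap.comp_apply, Localized.incl_proj]
  rw [counit_actL, apply_actR e he]

/-- The localized coalgebra `eCe`: its comultiplication is `exe ↦ ∑ e x₁ e ⊗ e x₂ e`, its counit
is the restriction of the counit of `C`. -/
instance Localized.coalgebra : Coalgebra K (Localized e he) where
  comul := Localized.comul e he
  counit := Coalgebra.counit ∘ₗ Localized.incl e he
  coassoc := by
    set p := Localized.proj e he
    have hp := Localized.comul_proj e he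
    rw [← LinearMap.cancel_right (Localized.proj_surjective e he)]
    have h1 : ∀ z : C ⊗[K] C, TensorProduct.assoc K _ _ _
        ((Localized.comul e he).rTensor _ (TensorProduct.map p p z)) =
        TensorProduct.map p (TensorProduct.map p p)
          (TensorProduct.assoc K C C C ((Coalgebra.comul (R := K) (A := C)).rTensor C z)) := by
      intro z
      induction z with
      | zero => simp
      | add a b ha hb => simp only [map_add, ha, hb]
      | tmul a b =>
        have ha := LinearMap.congr_fun hp a
        simp only [LinearMap.comp_apply] at ha
        simp only [TensorProduct.map_tmul, LinearMap.rTensor_tmul]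
        rw [ha]
        generalize Coalgebra.comul (R := K) a = y
        induction y with
        | zero => simp
        | add c d hc hd => simp only [map_add, TensorProduct.add_tmul, hc, hd]
        | tmul c d => simp [p]
    have h2 : ∀ z : C ⊗[K] C, (Localized.comul e he).lTensor _ (TensorProduct.map p p z) =
        TensorProduct.map p (TensorProduct.map p p)
          ((Coalgebra.comul (R := K) (A := C)).lTensor C z) := by
      intro z
      induction z with
      | zero => simp
      | add a b ha hb => simp only [map_add, ha, hb]
      | tmul a b =>
        have hb := LinearMap.congr_fun hp b
        simp only [LinearMap.comp_apply] at hb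
        simp only [TensorProduct.map_tmul, LinearMap.lTensor_tmul]
        rw [hb]
    apply LinearMap.ext
    intro x
    have hx := LinearMap.congr_fun hp x
    simp only [LinearMap.comp_apply, LinearEquiv.coe_coe] at hx ⊢
    rw [hx, h1, h2, coassoc_apply]
  rTensor_counit_comp_comul := by
    rw [← LinearMap.cancel_right (Localized.proj_surjective e he)]
    apply LinearMap.ext
    intro x
    have h : ∀ z : C ⊗[K] C, (Coalgebra.counit ∘ₗ Localized.incl e he).rTensor _
        (TensorProduct.map (Localized.proj e he) (Localized.proj e he) z) =
        (1 : K) ⊗ₜ[K] Localized.proj e he (TensorProduct.lid K C (e.ofConv.rTensor C z)) := by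
      intro z
      induction z with
      | zero => simp
      | add a b ha hb => simp only [map_add, ha, hb, TensorProduct.tmul_add]
      | tmul a b =>
        have ha := LinearMap.congr_fun (Localized.counit_proj e he) a
        rw [LinearMap.comp_apply] at ha
        simp only [TensorProduct.map_tmul, LinearMap.rTensor_tmul]
        rw [ha]
        simp [TensorProduct.tmul_smul, TensorProduct.smul_tmul']
    have hx := LinearMap.congr_fun (Localized.comul_proj e he) x
    have hy := LinearMap.congr_fun (Localized.proj_actR e he) x
    simp only [LinearMap.comp_apply] at hx hy ⊢
    rw [hx, h]
    exact congrArg (fun y => (1 : K) ⊗ₜ[K] y) hy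
  lTensor_counit_comp_comul := by
    rw [← LinearMap.cancel_right (Localized.proj_surjective e he)]
    apply LinearMap.ext
    intro x
    have h : ∀ z : C ⊗[K] C, (Coalgebra.counit ∘ₗ Localized.incl e he).lTensor _
        (TensorProduct.map (Localized.proj e he) (Localized.proj e he) z) =
        Localized.proj e he (TensorProduct.rid K C (e.ofConv.lTensor C z)) ⊗ₜ[K] (1 : K) := by
      intro z
      induction z with
      | zero => simp
      | add a b ha hb => simp only [map_add, ha, hb, TensorProduct.add_tmul]
      | tmul a b =>
        have hb := LinearMap.congr_fun (Localized.counit_proj e he) b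
        rw [LinearMap.comp_apply] at hb
        simp only [TensorProduct.map_tmul, LinearMap.lTensor_tmul]
        rw [hb]
        simp [TensorProduct.smul_tmul]
    have hx := LinearMap.congr_fun (Localized.comul_proj e he) x
    have hy := LinearMap.congr_fun (Localized.proj_actL e he) x
    simp only [LinearMap.comp_apply] at hx hy ⊢
    rw [hx, h]
    exact congrArg (fun y => y ⊗ₜ[K] (1 : K)) hy

/-- The right coaction `y ↦ ∑ y₁ e ⊗ y₂` of `C` on `Ce` (for `y` in `Ce` this is `∑ y₁ ⊗ y₂`). -/
def RightPart.coactR : RightPart e he →ₗ[K] RightPart e he ⊗[K] C :=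
  (RightPart.proj e he).rTensor C ∘ₗ Coalgebra.comul ∘ₗ RightPart.incl e he

/-- The left coaction `y ↦ ∑ e y₁ e ⊗ y₂ e` of `eCe` on `Ce`. -/
def RightPart.coactL : RightPart e he →ₗ[K] Localized e he ⊗[K] RightPart e he :=
  TensorProduct.map (Localized.proj e he) (RightPart.proj e he) ∘ₗ
    Coalgebra.comul ∘ₗ RightPart.incl e he

theorem RightPart.coactR_proj : RightPart.coactR e he ∘ₗ RightPart.proj e he =
    (RightPart.proj e he).rTensor C ∘ₗ Coalgebra.comul := by
  apply LinearMap.ext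
  intro x
  simp only [RightPart.coactR, LinearMap.comp_apply, RightPart.incl_proj]
  rw [comul_actR, ← LinearMap.rTensor_comp_apply, RightPart.proj_actR]

theorem RightPart.coactL_proj : RightPart.coactL e he ∘ₗ RightPart.proj e he =
    TensorProduct.map (Localized.proj e he) (RightPart.proj e he) ∘ₗ Coalgebra.comul := by
  apply LinearMap.ext
  intro x
  simp only [RightPart.coactL, LinearMap.comp_apply, RightPart.incl_proj]
  rw [comul_actR, LinearMap.rTensor, ← LinearMap.comp_apply, ← TensorProduct.map_comp,
    Localized.proj_actR, LinearMap.comp_id]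

instance RightPart.comodule : RightComodule K C (RightPart e he) where
  coact := RightPart.coactR e he
  coassoc := by
    rw [← LinearMap.cancel_right (RightPart.proj_surjective e he)]
    set p := RightPart.proj e he
    have hp := RightPart.coactR_proj e he
    have h1 : ∀ z : C ⊗[K] C, TensorProduct.assoc K _ C C
        ((RightPart.coactR e he).rTensor C (p.rTensor C z)) =
        p.rTensor (C ⊗[K] C)
          (TensorProduct.assoc K C C C ((Coalgebra.comul (R := K) (A := C)).rTensor C z)) := by
      intro z
      induction z with
      | zero => simp
      | add a b ha hb => simp only [map_add, ha, hb]
      | tmul a b =>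
        have ha := LinearMap.congr_fun hp a
        simp only [LinearMap.comp_apply] at ha
        simp only [LinearMap.rTensor_tmul]
        rw [ha]
        generalize Coalgebra.comul (R := K) a = y
        induction y with
        | zero => simp
        | add c d hc hd => simp only [map_add, TensorProduct.add_tmul, hc, hd]
        | tmul c d => simp [p]
    have h2 : ∀ z : C ⊗[K] C, (Coalgebra.comul (R := K) (A := C)).lTensor _ (p.rTensor C z) =
        p.rTensor (C ⊗[K] C) ((Coalgebra.comul (R := K) (A := C)).lTensor C z) := by
      intro z
      induction z with
      | zero => simp
      | add a b ha hb => simp only [map_add, ha, hb]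
      | tmul a b => simp
    apply LinearMap.ext
    intro x
    have hx := LinearMap.congr_fun hp x
    simp only [LinearMap.comp_apply, LinearEquiv.coe_coe] at hx ⊢
    rw [hx, h1, h2, coassoc_apply]
  counit := by
    rw [← LinearMap.cancel_right (RightPart.proj_surjective e he)]
    set p := RightPart.proj e he
    have h : ∀ z : C ⊗[K] C, (Coalgebra.counit (R := K) (A := C)).lTensor _ (p.rTensor C z) =
        p.rTensor K ((Coalgebra.counit (R := K) (A := C)).lTensor C z) := by
      intro z
      induction z with
      | zero => simp
      | add a b ha hb => simp only [map_add, ha, hb]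
      | tmul a b => simp
    apply LinearMap.ext
    intro x
    have hx := LinearMap.congr_fun (RightPart.coactR_proj e he) x
    simp only [LinearMap.comp_apply] at hx ⊢
    rw [hx, h, lTensor_counit_comul]
    simp [p]

theorem RightPart.coactL_isComoduleHom : IsComoduleHom K C (RightPart.coactL e he) := by
  unfold IsComoduleHom
  rw [← LinearMap.cancel_right (RightPart.proj_surjective e he)]
  set p := RightPart.proj e he with hpdef
  set q := Localized.proj e he
  have hR := RightPart.coactR_proj e he
  have hL := RightPart.coactL_proj e he
  have h1 : ∀ z : C ⊗[K] C, (RightPart.coactL e he).rTensor C (p.rTensor C z) =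
      (TensorProduct.map q p).rTensor C ((Coalgebra.comul (R := K) (A := C)).rTensor C z) := by
    intro z
    rw [← LinearMap.rTensor_comp_apply, hL, LinearMap.rTensor_comp_apply]
  have h2 : ∀ z : C ⊗[K] C, coact K C (Localized e he ⊗[K] RightPart e he)
      (TensorProduct.map q p z) = (TensorProduct.map q p).rTensor C
        ((TensorProduct.assoc K C C C).symm ((Coalgebra.comul (R := K) (A := C)).lTensor C z)) := by
    intro z
    induction z with
    | zero => simp
    | add a b ha hb => simp only [map_add, ha, hb]
    | tmul a b =>
      have hb := LinearMap.congr_fun hR b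
      simp only [LinearMap.comp_apply] at hb
      rw [TensorProduct.map_tmul]
      refine (tensorCoact_tmul K C K (Localized e he) (RightPart e he) (q a) (p b)).trans ?_
      change (tmulLeft K K _ _ (q a)).rTensor C (RightPart.coactR e he (p b)) = _
      rw [hb, LinearMap.lTensor_tmul]
      generalize Coalgebra.comul (R := K) b = y
      induction y with
      | zero => simp
      | add c d hc hd => simp only [map_add, TensorProduct.tmul_add, hc, hd]
      | tmul c d => simp [tmulLeft, hpdef]
  apply LinearMap.ext
  intro x
  have hx := LinearMap.congr_fun hL x
  have hy := LinearMap.congr_fun hR x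
  simp only [LinearMap.comp_apply] at hx hy ⊢
  change _ = (RightPart.coactL e he).rTensor C (RightPart.coactR e he (p x))
  rw [hx, hy, h1, h2, coassoc_symm_apply]

/-! The cotensor product. -/

variable (N : Type w) [AddCommGroup N] [Module K N]

/-- The map `N ⊗ Ce → N ⊗ (eCe ⊗ Ce)` given by the coaction on `N`. -/
def cotensorLeft [RightComodule K (Localized e he) N] : N ⊗[K] RightPart e he →ₗ[K]
    N ⊗[K] (Localized e he ⊗[K] RightPart e he) :=
  (TensorProduct.assoc K N (Localized e he) (RightPart e he)).toLinearMap ∘ₗ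
    (coact K (Localized e he) N).rTensor (RightPart e he)

/-- The map `N ⊗ Ce → N ⊗ (eCe ⊗ Ce)` given by the left coaction on `Ce`. -/
def cotensorRight : N ⊗[K] RightPart e he →ₗ[K]
    N ⊗[K] (Localized e he ⊗[K] RightPart e he) :=
  (RightPart.coactL e he).lTensor N

/-- The value `S(N)` of the section functor `S = - □ Ce` at the right `eCe`-comodule `N`: the
cotensor product of `N` and `Ce` over `eCe`, as a subspace of `N ⊗ Ce`. -/
def SectionSpace [RightComodule K (Localized e he) N] : Submodule K (N ⊗[K] RightPart e he) :=
  LinearMap.eqLocus (cotensorLeft e he N) (cotensorRight e he N)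

theorem cotensorLeft_isComoduleHom [RightComodule K (Localized e he) N] :
    IsComoduleHom K C (cotensorLeft e he N) := by
  apply LinearMap.ext
  intro x
  induction x with
  | zero => simp
  | add a b ha hb => simp only [map_add, ha, hb]
  | tmul n y =>
    have h : ∀ w : N ⊗[K] Localized e he,
        coact K C (N ⊗[K] (Localized e he ⊗[K] RightPart e he))
          (TensorProduct.assoc K N (Localized e he) (RightPart e he) (w ⊗ₜ y)) =
        ((TensorProduct.assoc K N (Localized e he) (RightPart e he)).toLinearMap ∘ₗ
          TensorProduct.mk K _ _ w).rTensor C (coact K C (RightPart e he) y) := by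
      intro w
      induction w with
      | zero => simp
      | add a b ha hb =>
        simp only [map_add, TensorProduct.add_tmul, ha, hb, LinearMap.comp_add,
          LinearMap.rTensor_add, LinearMap.add_apply]
      | tmul a d =>
        rw [TensorProduct.assoc_tmul]
        refine (tensorCoact_tmul K C K N _ a (d ⊗ₜ y)).trans ?_
        have h2 : coact K C (Localized e he ⊗[K] RightPart e he) (d ⊗ₜ y) = _ :=
          tensorCoact_tmul K C K (Localized e he) (RightPart e he) d y
        rw [h2, ← LinearMap.rTensor_comp_apply]
        rfl
    have h3 : coact K C (N ⊗[K] RightPart e he) (n ⊗ₜ y) = _ :=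
      tensorCoact_tmul K C K N (RightPart e he) n y
    simp only [LinearMap.comp_apply]
    rw [h3, ← LinearMap.rTensor_comp_apply]
    exact h _

theorem cotensorRight_isComoduleHom : IsComoduleHom K C (cotensorRight e he N) := by
  apply LinearMap.ext
  intro x
  induction x with
  | zero => simp
  | add a b ha hb => simp only [map_add, ha, hb]
  | tmul n y =>
    have h3 : coact K C (N ⊗[K] RightPart e he) (n ⊗ₜ y) = _ :=
      tensorCoact_tmul K C K N (RightPart e he) n y
    have h4 : coact K C (N ⊗[K] (Localized e he ⊗[K] RightPart e he))
        (n ⊗ₜ RightPart.coactL e he y) = _ :=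
      tensorCoact_tmul K C K N (Localized e he ⊗[K] RightPart e he) n (RightPart.coactL e he y)
    have h5 := LinearMap.congr_fun (RightPart.coactL_isComoduleHom e he) y
    simp only [LinearMap.comp_apply] at h5 ⊢
    rw [h3, ← LinearMap.rTensor_comp_apply]
    refine h4.trans ?_
    rw [h5, ← LinearMap.rTensor_comp_apply]
    rfl

/-- `S(N)` is a right `C`-comodule, with the coaction of `C` on `Ce`. -/
instance SectionSpace.comodule [RightComodule K (Localized e he) N] :
    RightComodule K C (SectionSpace e he N) :=
  subcomodule (isSubcomodule_eqLocus (cotensorLeft_isComoduleHom e he N)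
    (cotensorRight_isComoduleHom e he N))

/-- The section functor `S` on objects, from right `eCe`-comodules to right `C`-comodules. -/
def sectionFunctor (N : Comod.{u, v, w} K (Localized e he)) : Comod.{u, v, max v w} K C where
  carrier := SectionSpace e he N.carrier

end Localization

end CoalgLoc

end

/-!
The localization functor `T : M ↦ eM` from right `C`-comodules to right `eCe`-comodules has the
section functor `S` as a right inverse, so `eCe`-comodules can be classified by applying `T` to the
classification of `C`-comodules.

The relation "`N` is the localization of `M`" is expressed by `IsLocalizedBy`: a pair of maps
splitting the idempotent endomorphism `x ↦ e x` of `M`, compatible with the coactions. It determines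
`N` up to isomorphism (`IsLocalizedBy.comoduleIso`), exists for every `R`-`C`-bimodule
(`isLocalizedBy_localizedComodule`), commutes with `A ⊗[R] -` (`IsLocalizedBy.tensor`), and relates
`N` to `S(N)` (`isLocalizedBy_sectionSpace`). As `eL` is a direct summand of `L` over `K[t]`,
localization keeps bimodules finitely generated and free.

Let `v` be a length vector of `eCe` and `N` an indecomposable comodule with that length vector.

* `S(N)` is indecomposable: a decomposition of `S(N)` localizes to one of `N`, so `e` kills one of
  the summands, and `e` kills no nonzero subcomodule of `N ⊗ Ce` (`eq_bot_of_dualAct_eq_zero`).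
* `S` is left exact (`sectionMap_exact`) and finite-dimensional on simple comodules, so `S(N)` is
  finite-dimensional and its length vector is bounded in terms of `v` alone
  (`exists_bound_lengthVector_section`). Hence only finitely many length vectors `w` of `C` occur.

For each such `w`, almost all possible `S(N)` are of the form `K[t] / (t - a) ⊗ L` for one of `r w`
bimodules `L`, and then `N` is `K[t] / (t - a) ⊗ eL`. So the bimodules `eL`, for all the `w` that
occur, suffice for `v`; if every `r w` is `0`, then none are needed.
-/

noncomputable section

namespace CoalgLoc

/-! ### Comodules, subcomodules and quotients -/

section General

variable {K : Type*} {C : Type*} [Field K] [AddCommGroup C] [Module K C] [Coalgebra K C]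

/-- A surjection `p : M → N` and a comultiplicative map `π : C → D` carry a `C`-comodule structure
on `M` to a `D`-comodule structure on `N`, as soon as the coaction descends to `ρ : N → N ⊗ D`.
Since `π` need not preserve counits, the counit law is required separately, in the form
`∑ ε(π(x₁)) p(x₀) = p(x)`. -/
@[reducible]
def inducedComodule {D M N : Type*} [AddCommGroup D] [Module K D] [Coalgebra K D]
    [AddCommGroup M] [Module K M] [RightComodule K C M] [AddCommGroup N] [Module K N]
    (π : C →ₗ[K] D) (hπ : comul (R := K) ∘ₗ π = TensorProduct.map π π ∘ₗ comul)
    (p : M →ₗ[K] N) (hp : Function.Surjective p) (ρ : N →ₗ[K] N ⊗[K] D)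
    (hρ : ρ ∘ₗ p = TensorProduct.map p π ∘ₗ coact K C M)
    (hc : ∀ x, TensorProduct.rid K N (TensorProduct.map p (Coalgebra.counit ∘ₗ π)
      (coact K C M x)) = p x) : RightComodule K D N where
  coact := ρ
  coassoc := by
    rw [← LinearMap.cancel_right hp]
    have h1 : ∀ z : M ⊗[K] C, TensorProduct.assoc K _ _ _
        (ρ.rTensor _ (TensorProduct.map p π z)) =
        TensorProduct.map p (TensorProduct.map π π)
          (TensorProduct.assoc K M C C ((coact K C M).rTensor C z)) := by
      intro z
      induction z with
      | zero => simp
      | add a b ha hb => simp only [map_add, ha, hb]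
      | tmul a b =>
        have ha := LinearMap.congr_fun hρ a
        simp only [LinearMap.comp_apply] at ha
        simp only [TensorProduct.map_tmul, LinearMap.rTensor_tmul]
        rw [ha]
        generalize coact K C M a = y
        induction y with
        | zero => simp
        | add c d hc hd => simp only [map_add, TensorProduct.add_tmul, hc, hd]
        | tmul c d => simp
    have h2 : ∀ z : M ⊗[K] C, (comul (R := K) (A := D)).lTensor N (TensorProduct.map p π z) =
        TensorProduct.map p (TensorProduct.map π π)
          ((Coalgebra.comul (R := K) (A := C)).lTensor M z) := by
      intro z
      induction z with
      | zero => simp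
      | add a b ha hb => simp only [map_add, ha, hb]
      | tmul a b =>
        have hb := LinearMap.congr_fun hπ b
        simp only [LinearMap.comp_apply] at hb
        simp only [TensorProduct.map_tmul, LinearMap.lTensor_tmul]
        rw [hb]
    apply LinearMap.ext
    intro x
    have hx := LinearMap.congr_fun hρ x
    have h3 := LinearMap.congr_fun (RightComodule.coassoc (K := K) (C := C) (M := M)) x
    simp only [LinearMap.comp_apply, LinearEquiv.coe_coe] at hx h3 ⊢
    rw [hx, h1, h2]
    exact congrArg _ h3
  counit := by
    rw [← LinearMap.cancel_right hp]
    apply LinearMap.ext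
    intro x
    have hx := LinearMap.congr_fun hρ x
    simp only [LinearMap.comp_apply] at hx ⊢
    rw [hx]
    apply (TensorProduct.rid K N).injective
    refine Eq.trans ?_ ((hc x).trans (by simp))
    rw [LinearMap.lTensor, TensorProduct.map_map, LinearMap.id_comp]

variable {M : Type*} [AddCommGroup M] [Module K M] [RightComodule K C M]
  {N : Type*} [AddCommGroup N] [Module K N] [RightComodule K C N]
  {L : Type*} [AddCommGroup L] [Module K L] [RightComodule K C L]

theorem rid_lTensor_counit_coact (x : M) :
    TensorProduct.rid K M ((Coalgebra.counit (R := K) (A := C)).lTensor M (coact K C M x)) = x := by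
  have h := LinearMap.congr_fun (RightComodule.counit (K := K) (C := C) (M := M)) x
  refine (congrArg (TensorProduct.rid K M) h).trans ?_
  simp

theorem IsComoduleHom.apply {f : M →ₗ[K] N} (hf : IsComoduleHom K C f) (x : M) :
    coact K C N (f x) = f.rTensor C (coact K C M x) :=
  LinearMap.congr_fun hf x

theorem IsComoduleHom.comp {g : N →ₗ[K] L} {f : M →ₗ[K] N} (hg : IsComoduleHom K C g)
    (hf : IsComoduleHom K C f) : IsComoduleHom K C (g ∘ₗ f) := by
  apply LinearMap.ext
  intro x
  simp only [LinearMap.comp_apply]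
  rw [hg.apply, hf.apply, ← LinearMap.rTensor_comp_apply]

/-- A linear map is a comodule homomorphism if it becomes one after composition with an injective
comodule homomorphism. -/
theorem IsComoduleHom.of_comp_injective {g : N →ₗ[K] L} {f : M →ₗ[K] N} (hg : IsComoduleHom K C g)
    (hgi : Function.Injective g) (h : IsComoduleHom K C (g ∘ₗ f)) : IsComoduleHom K C f := by
  apply LinearMap.ext
  intro x
  apply Module.Flat.rTensor_preserves_injective_linearMap (M := C) g hgi
  have := h.apply x
  simp only [LinearMap.comp_apply] at this ⊢
  rw [← hg.apply, this, LinearMap.rTensor_comp_apply]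

theorem IsComoduleHom.symm {f : M ≃ₗ[K] N} (hf : IsComoduleHom K C f.toLinearMap) :
    IsComoduleHom K C f.symm.toLinearMap :=
  IsComoduleHom.of_comp_injective hf f.injective
    (by apply LinearMap.ext; intro x; simp)

theorem isComoduleHom_zero : IsComoduleHom K C (0 : M →ₗ[K] N) := by
  simp [IsComoduleHom]

theorem isSubcomodule_ker {f : M →ₗ[K] N} (hf : IsComoduleHom K C f) :
    IsSubcomodule K C (LinearMap.ker f) := by
  have h := isSubcomodule_eqLocus hf (isComoduleHom_zero (N := N))
  rwa [LinearMap.eqLocus_eq_ker_sub, sub_zero] at h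

theorem isSubcomodule_bot : IsSubcomodule K C (⊥ : Submodule K M) := by
  intro x hx
  rw [(Submodule.mem_bot K).1 hx, map_zero]
  exact Submodule.zero_mem _

theorem isComoduleHom_subtype {P : Submodule K M} (hP : IsSubcomodule K C P) :
    letI := subcomodule hP
    IsComoduleHom K C P.subtype :=
  (subtype_comp_subCoact hP).symm

/-- The image of a subcomodule under a map that is compatible with the coactions, along a linear
map `π` of the coalgebras, is a subcomodule. -/
theorem IsSubcomodule.map_of_comp {D : Type*} [AddCommGroup D] [Module K D] [Coalgebra K D]
    {Q : Type*} [AddCommGroup Q] [Module K Q] [RightComodule K D Q] {π : C →ₗ[K] D}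
    {p : M →ₗ[K] Q} (hp : ∀ x, coact K D Q (p x) = TensorProduct.map p π (coact K C M x))
    {P : Submodule K M} (hP : IsSubcomodule K C P) : IsSubcomodule K D (P.map p) := by
  rintro _ ⟨x, hx, rfl⟩
  obtain ⟨z, hz⟩ := hP x hx
  rw [hp, ← hz]
  refine ⟨TensorProduct.map (p.submoduleMap P) π z, ?_⟩
  clear hz
  induction z with
  | zero => simp
  | add a b ha hb => simp only [map_add, ha, hb]
  | tmul a b => simp

theorem IsSubcomodule.map {f : M →ₗ[K] N} (hf : IsComoduleHom K C f) {P : Submodule K M}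
    (hP : IsSubcomodule K C P) : IsSubcomodule K C (P.map f) :=
  IsSubcomodule.map_of_comp (π := LinearMap.id) (fun x => hf.apply x) hP

theorem isSubcomodule_range {f : M →ₗ[K] N} (hf : IsComoduleHom K C f) :
    IsSubcomodule K C (LinearMap.range f) := by
  rw [LinearMap.range_eq_map]
  refine IsSubcomodule.map hf fun x _ => ?_
  exact LinearMap.rTensor_surjective C (g := (⊤ : Submodule K M).subtype)
    (fun y => ⟨⟨y, Submodule.mem_top⟩, rfl⟩) _

/-- The coaction on the quotient by a subcomodule. -/
def quotCoact {P : Submodule K M} (hP : IsSubcomodule K C P) : (M ⧸ P) →ₗ[K] (M ⧸ P) ⊗[K] C :=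
  P.liftQ (P.mkQ.rTensor C ∘ₗ coact K C M) (by
    intro x hx
    obtain ⟨z, hz⟩ := hP x hx
    rw [LinearMap.mem_ker, LinearMap.comp_apply, ← hz, ← LinearMap.rTensor_comp_apply]
    have : P.mkQ ∘ₗ P.subtype = 0 := by ext; simp
    rw [this, LinearMap.rTensor_zero, LinearMap.zero_apply])

/-- The quotient of a comodule by a subcomodule. -/
@[reducible]
def quotComodule {P : Submodule K M} (hP : IsSubcomodule K C P) : RightComodule K C (M ⧸ P) :=
  inducedComodule (C := C) LinearMap.id (by simp) P.mkQ P.mkQ_surjective (quotCoact hP)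
    (P.liftQ_mkQ _ _) (by
      intro x
      have : TensorProduct.map P.mkQ (Coalgebra.counit (R := K) (A := C)) =
          P.mkQ.rTensor K ∘ₗ (Coalgebra.counit (R := K) (A := C)).lTensor M := by
        rw [LinearMap.rTensor_comp_lTensor]
      rw [LinearMap.comp_id, this, LinearMap.comp_apply]
      conv_rhs => rw [← rid_lTensor_counit_coact (K := K) (C := C) x]
      generalize (Coalgebra.counit (R := K) (A := C)).lTensor M (coact K C M x) = z
      induction z with
      | zero => simp
      | add a b ha hb => simp only [map_add, ha, hb]
      | tmul a b => simp)

theorem isComoduleHom_mkQ {P : Submodule K M} (hP : IsSubcomodule K C P) :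
    letI := quotComodule hP
    IsComoduleHom K C P.mkQ :=
  P.liftQ_mkQ _ _

end General

/-! ### Length vectors -/

section Length

variable {K C : Type u} [Field K] [AddCommGroup C] [Module K C] [Coalgebra K C]

/-- A subcomodule, as a bundled comodule. -/
def Comod.sub (M : Comod.{u, u, u} K C) {P : Submodule K M.carrier} (hP : IsSubcomodule K C P) :
    Comod.{u, u, u} K C :=
  letI := subcomodule hP
  ⟨P⟩

/-- The quotient by a subcomodule, as a bundled comodule. -/
def Comod.quot (M : Comod.{u, u, u} K C) {P : Submodule K M.carrier} (hP : IsSubcomodule K C P) :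
    Comod.{u, u, u} K C :=
  letI := quotComodule hP
  ⟨M.carrier ⧸ P⟩

theorem HasLengthVector.nonneg {M : Comod.{u, u, u} K C} {v : GrothendieckGroup K C}
    (h : HasLengthVector M v) : 0 ≤ v := by
  induction h with
  | zero M hM => exact le_rfl
  | step M' M S hS f g hf hg fi gs ex v hM' ih =>
    exact add_nonneg ih (Finsupp.single_nonneg.2 zero_le_one)

theorem HasLengthVector.of_iso {A M : Comod.{u, u, u} K C} {a : GrothendieckGroup K C}
    (hA : HasLengthVector A a) (i : A.carrier ≃ₗ[K] M.carrier)
    (hi : IsComoduleHom K C i.toLinearMap) : HasLengthVector M a := by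
  cases hA with
  | zero _ h => exact .zero M (i.toEquiv.symm.subsingleton)
  | step M' _ S hS f g hf hg fi gs ex v hM' =>
    refine .step M' M S hS (i.toLinearMap ∘ₗ f) (g ∘ₗ i.symm.toLinearMap) (hi.comp hf)
      (hg.comp hi.symm) (i.injective.comp fi) (gs.comp i.symm.surjective) ?_ v hM'
    intro y
    constructor
    · intro hy
      obtain ⟨x, hx⟩ := (ex (i.symm y)).1 hy
      exact ⟨x, by simp [hx]⟩
    · rintro ⟨x, rfl⟩
      simpa using ex.apply_apply_eq_zero x

/-- A nonzero map into a simple comodule is surjective. -/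
theorem IsSimpleComodule.eq_zero_or_surjective {S : Type*} [AddCommGroup S] [Module K S]
    [RightComodule K C S] (hS : IsSimpleComodule K C S) {M : Type*} [AddCommGroup M] [Module K M]
    [RightComodule K C M] {g : M →ₗ[K] S} (hg : IsComoduleHom K C g) :
    g = 0 ∨ Function.Surjective g :=
  (hS.2 _ (isSubcomodule_range hg)).imp LinearMap.range_eq_bot.1 LinearMap.range_eq_top.1

/-- In a left exact sequence `0 → A → M → B`, the length vector of `M` exists and is at most the
sum of those of `A` and `B`. -/
theorem HasLengthVector.exists_le_add_of_exact {B : Comod.{u, u, u} K C}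
    {b : GrothendieckGroup K C} (hB : HasLengthVector B b) {A : Comod.{u, u, u} K C}
    {a : GrothendieckGroup K C} (hA : HasLengthVector A a) (M : Comod.{u, u, u} K C)
    (i : A.carrier →ₗ[K] M.carrier) (hi : IsComoduleHom K C i) (i_inj : Function.Injective i)
    (φ : M.carrier →ₗ[K] B.carrier) (hφ : IsComoduleHom K C φ) (ex : Function.Exact i φ) :
    ∃ w ≤ b + a, HasLengthVector M w := by
  induction hB generalizing M with
  | zero B hB =>
    refine ⟨a, by simp, hA.of_iso (LinearEquiv.ofBijective i ⟨i_inj, fun y => ?_⟩) hi⟩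
    exact (ex y).1 (Subsingleton.elim _ _)
  | step B' B S hS f g hf hg fi gs exB b hB' ih =>
    rcases hS.eq_zero_or_surjective (hg.comp hφ) with h0 | hsurj
    · -- `φ` factors through `B'`.
      let fe := LinearEquiv.ofInjective f fi
      have hr : ∀ x, φ x ∈ LinearMap.range f := fun x => (exB _).1 (LinearMap.congr_fun h0 x)
      let ψ : M.carrier →ₗ[K] B'.carrier := fe.symm.toLinearMap ∘ₗ φ.codRestrict _ hr
      have hψ : ∀ x, f (ψ x) = φ x := fun x => by
        have := fe.apply_symm_apply (φ.codRestrict _ hr x)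
        exact congrArg Subtype.val this
      have hψ' : f ∘ₗ ψ = φ := LinearMap.ext hψ
      obtain ⟨w, hw, h⟩ := ih M i hi i_inj ψ
        (IsComoduleHom.of_comp_injective hf fi (by rw [hψ']; exact hφ)) (fun y => by
          rw [← ex y, ← hψ, map_eq_zero_iff f fi])
      exact ⟨w, hw.trans (by
        rw [add_right_comm]
        exact le_add_of_nonneg_right (Finsupp.single_nonneg.2 zero_le_one)), h⟩
    · -- The kernel `M'` of `M → S` maps to `B'`, with the same kernel `A`.
      have hM' := isSubcomodule_ker (hg.comp hφ)
      let M' := M.sub hM'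
      let j : M'.carrier →ₗ[K] M.carrier := (LinearMap.ker (g ∘ₗ φ)).subtype
      have hj : IsComoduleHom K C j := isComoduleHom_subtype hM'
      have j_inj : Function.Injective j := Subtype.val_injective
      let fe := LinearEquiv.ofInjective f fi
      have hr : ∀ x : M'.carrier, (φ ∘ₗ j) x ∈ LinearMap.range f := fun x => (exB _).1 x.2
      let ψ : M'.carrier →ₗ[K] B'.carrier := fe.symm.toLinearMap ∘ₗ (φ ∘ₗ j).codRestrict _ hr
      have hψ : ∀ x, f (ψ x) = φ (j x) := fun x => by
        have := fe.apply_symm_apply ((φ ∘ₗ j).codRestrict _ hr x)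
        exact congrArg Subtype.val this
      have hψ' : f ∘ₗ ψ = φ ∘ₗ j := LinearMap.ext hψ
      have hi' : ∀ x, i x ∈ LinearMap.ker (g ∘ₗ φ) := fun x => by
        simp [ex.apply_apply_eq_zero x]
      let i' : A.carrier →ₗ[K] M'.carrier := i.codRestrict _ hi'
      have hji : j ∘ₗ i' = i := rfl
      obtain ⟨w, hw, h⟩ := ih M' i'
        (IsComoduleHom.of_comp_injective hj j_inj (by rw [hji]; exact hi))
        (fun x y hxy => i_inj (congrArg j hxy)) ψ
        (IsComoduleHom.of_comp_injective hf fi (by rw [hψ']; exact hφ.comp hj)) (fun y => by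
          rw [← map_eq_zero_iff f fi, hψ, ex (j y)]
          constructor
          · rintro ⟨x, hx⟩
            exact ⟨x, j_inj hx⟩
          · rintro ⟨x, rfl⟩
            exact ⟨x, rfl⟩)
      refine ⟨_, ?_, .step M' M S hS j (g ∘ₗ φ) hj (hg.comp hφ) j_inj hsurj ?_ w h⟩
      · rw [add_right_comm]
        gcongr
      · exact LinearMap.exact_subtype_ker_map _

theorem IsSimpleComodule.hasLengthVector (S : Comod.{u, u, u} K C)
    (hS : IsSimpleComodule K C S.carrier) :
    HasLengthVector S (0 + Finsupp.single (SimpleClass.mk K C S hS) 1) := by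
  let Z := S.sub isSubcomodule_bot
  refine .step Z S S hS (⊥ : Submodule K S.carrier).subtype LinearMap.id
    (isComoduleHom_subtype isSubcomodule_bot) (by simp [IsComoduleHom]) Subtype.val_injective
    Function.surjective_id ?_ 0 (.zero Z ?_)
  · intro y
    constructor
    · rintro rfl
      exact ⟨0, rfl⟩
    · rintro ⟨x, rfl⟩
      exact (Submodule.mem_bot K).1 x.2
  · exact inferInstanceAs (Subsingleton (⊥ : Submodule K S.carrier))

/-- A finite-dimensional comodule has a composition series. -/
theorem exists_hasLengthVector (M : Comod.{u, u, u} K C) [FiniteDimensional K M.carrier] :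
    ∃ w, HasLengthVector M w := by
  induction h : Module.finrank K M.carrier using Nat.strong_induction_on generalizing M with
  | _ n ih =>
  rcases subsingleton_or_nontrivial M.carrier with h0 | h0
  · exact ⟨0, .zero M h0⟩
  -- A nonzero subcomodule of least dimension is simple.
  have hne : {P : Submodule K M.carrier | IsSubcomodule K C P ∧ P ≠ ⊥}.Nonempty := by
    refine ⟨⊤, ?_, top_ne_bot⟩
    have := isSubcomodule_range (K := K) (C := C) (f := (LinearMap.id : M.carrier →ₗ[K] M.carrier))
      (by simp [IsComoduleHom])
    rwa [LinearMap.range_id] at this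
  obtain ⟨P, ⟨hP, hP0⟩, hmin⟩ :=
    WellFounded.has_min (wellFounded_lt (α := Submodule K M.carrier)) _ hne
  have hj := isComoduleHom_subtype hP
  have hS : IsSimpleComodule K C (M.sub hP).carrier := by
    refine ⟨P.nontrivial_iff_ne_bot.2 hP0, fun Q hQ => ?_⟩
    let _ := subcomodule hP
    change Submodule K P at Q
    by_cases hQ0 : Q = ⊥
    · exact Or.inl hQ0
    right
    have hQ' : IsSubcomodule K C (Q.map P.subtype) := IsSubcomodule.map hj hQ
    have h1 := hmin _ ⟨hQ', fun h => hQ0 <|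
      Submodule.map_injective_of_injective P.injective_subtype (h.trans (Submodule.map_bot _).symm)⟩
    have h2 : Q.map P.subtype = P :=
      (Submodule.map_subtype_le P Q).eq_of_not_lt h1
    exact Submodule.map_injective_of_injective P.injective_subtype
      (h2.trans (Submodule.map_subtype_top P).symm)
  have : FiniteDimensional K (M.quot hP).carrier :=
    inferInstanceAs (FiniteDimensional K (M.carrier ⧸ P))
  have hlt : Module.finrank K (M.quot hP).carrier < n := by
    have h1 := P.finrank_quotient_add_finrank
    have h2 := Submodule.one_le_finrank_iff.2 hP0
    change Module.finrank K (M.carrier ⧸ P) < n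
    omega
  obtain ⟨b, hb⟩ := ih _ hlt (M.quot hP) rfl
  obtain ⟨w, -, hw⟩ := hb.exists_le_add_of_exact (IsSimpleComodule.hasLengthVector _ hS) M
    P.subtype hj P.injective_subtype P.mkQ (isComoduleHom_mkQ hP)
    (LinearMap.exact_subtype_mkQ P)
  exact ⟨w, hw⟩

end Length

/-! ### The localization functor `M ↦ eM` -/

section LocalizationFunctor

variable {K : Type*} {C : Type*} [Field K] [AddCommGroup C] [Module K C] [Coalgebra K C]
  (e : WithConv (C →ₗ[K] K)) (he : IsIdempotentElem e)

/-- The action `x ↦ e x = ∑ x₀ e(x₁)` of an element of the dual algebra on a right comodule. -/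
def dualAct (M : Type*) [AddCommGroup M] [Module K M] [RightComodule K C M] : M →ₗ[K] M :=
  (TensorProduct.rid K M).toLinearMap ∘ₗ e.ofConv.lTensor M ∘ₗ coact K C M

variable {M : Type*} [AddCommGroup M] [Module K M] [RightComodule K C M]
  {M' : Type*} [AddCommGroup M'] [Module K M'] [RightComodule K C M']
  {N : Type*} [AddCommGroup N] [Module K N] [RightComodule K (Localized e he) N]
  {N' : Type*} [AddCommGroup N'] [Module K N'] [RightComodule K (Localized e he) N']

theorem dualAct_apply (x : M) :
    dualAct e M x = TensorProduct.rid K M (e.ofConv.lTensor M (coact K C M x)) :=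
  rfl

theorem IsComoduleHom.map_dualAct {f : M →ₗ[K] M'} (hf : IsComoduleHom K C f) (x : M) :
    f (dualAct e M x) = dualAct e M' (f x) := by
  rw [dualAct_apply, dualAct_apply, hf.apply]
  generalize coact K C M x = z
  induction z with
  | zero => simp
  | add a b ha hb => simp only [map_add, ha, hb]
  | tmul a b => simp

theorem coact_dualAct (x : M) :
    coact K C M (dualAct e M x) = (actL e).lTensor M (coact K C M x) := by
  have h : ∀ z : M ⊗[K] C, coact K C M (TensorProduct.rid K M (e.ofConv.lTensor M z)) =
      ((TensorProduct.rid K C).toLinearMap ∘ₗ e.ofConv.lTensor C).lTensor M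
        (TensorProduct.assoc K M C C ((coact K C M).rTensor C z)) := by
    intro z
    induction z with
    | zero => simp
    | add a b ha hb => simp only [map_add, ha, hb]
    | tmul a b =>
      simp only [LinearMap.rTensor_tmul, LinearMap.lTensor_tmul, TensorProduct.rid_tmul, map_smul]
      generalize coact K C M a = y
      induction y with
      | zero => simp
      | add c d hc hd => simp only [map_add, TensorProduct.add_tmul, smul_add, hc, hd]
      | tmul c d => simp
  have h3 := LinearMap.congr_fun (RightComodule.coassoc (K := K) (C := C) (M := M)) x
  rw [dualAct_apply, h]
  refine (congrArg _ h3).trans ?_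
  rw [LinearMap.comp_apply, ← LinearMap.lTensor_comp_apply]
  rfl

theorem dualAct_dualAct (hi : IsIdempotentElem e) (x : M) :
    dualAct e M (dualAct e M x) = dualAct e M x := by
  have h : e.ofConv ∘ₗ actL e = e.ofConv := LinearMap.ext (apply_actL e hi)
  rw [dualAct_apply e (dualAct e M x), coact_dualAct, ← LinearMap.lTensor_comp_apply, h]
  rfl

theorem dualAct_mem {P : Submodule K M} (hP : IsSubcomodule K C P) {x : M} (hx : x ∈ P) :
    dualAct e M x ∈ P := by
  obtain ⟨z, hz⟩ := hP x hx
  rw [dualAct_apply, ← hz]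
  clear hz
  induction z with
  | zero => simp
  | add a b ha hb => simpa only [map_add] using P.add_mem ha hb
  | tmul a b => simpa using P.smul_mem _ a.2

/-- `p : M → N` and `i : N → M` exhibit the `eCe`-comodule `N` as the localization `eM` of the
`C`-comodule `M`: they split the idempotent `x ↦ e x`, and the coaction of `N` is
`e x ↦ ∑ e x₀ ⊗ e x₁ e`. -/
structure IsLocalizedBy (p : M →ₗ[K] N) (i : N →ₗ[K] M) : Prop where
  proj_incl : ∀ y, p (i y) = y
  incl_proj : ∀ x, i (p x) = dualAct e M x
  coact_proj : ∀ x, coact K (Localized e he) N (p x) =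
    TensorProduct.map p (Localized.proj e he) (coact K C M x)

namespace IsLocalizedBy

variable {e he} {p : M →ₗ[K] N} {i : N →ₗ[K] M} {p' : M' →ₗ[K] N'} {i' : N' →ₗ[K] M'}

theorem proj_dualAct (h : IsLocalizedBy e he p i) (x : M) : p (dualAct e M x) = p x := by
  rw [← h.incl_proj, h.proj_incl]

theorem isComoduleHom (h : IsLocalizedBy e he p i) (h' : IsLocalizedBy e he p' i')
    {f : M →ₗ[K] M'} (hf : IsComoduleHom K C f) :
    IsComoduleHom K (Localized e he) (p' ∘ₗ f ∘ₗ i) := by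
  apply LinearMap.ext
  intro y
  have hc : (p' ∘ₗ f ∘ₗ i) ∘ₗ p = p' ∘ₗ f := by
    ext x
    simp only [LinearMap.comp_apply]
    rw [h.incl_proj, hf.map_dualAct, h'.proj_dualAct]
  have h1 := h.coact_proj (i y)
  rw [h.proj_incl] at h1
  simp only [LinearMap.comp_apply]
  rw [h'.coact_proj, hf.apply, h1, LinearMap.rTensor, LinearMap.rTensor, TensorProduct.map_map,
    TensorProduct.map_map, hc, LinearMap.comp_id, LinearMap.id_comp]

/-- Isomorphic comodules have isomorphic localizations. -/
theorem comoduleIso (h : IsLocalizedBy e he p i) (h' : IsLocalizedBy e he p' i')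
    (hM : ComoduleIso K C M M') : ComoduleIso K (Localized e he) N N' := by
  obtain ⟨f, hf⟩ := hM
  refine ⟨LinearEquiv.ofLinearMap (p' ∘ₗ f.toLinearMap ∘ₗ i) (p ∘ₗ f.symm.toLinearMap ∘ₗ i') ?_ ?_,
    h.isComoduleHom h' hf⟩
  · ext y
    have := hf.map_dualAct e (f.symm (i' y))
    simp only [LinearEquiv.coe_coe, LinearEquiv.apply_symm_apply] at this
    simp [h.incl_proj, this, h'.proj_dualAct, h'.proj_incl]
  · ext y
    have := hf.symm.map_dualAct e (f (i y))
    simp only [LinearEquiv.coe_coe, LinearEquiv.symm_apply_apply] at this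
    simp [h'.incl_proj, this, h.proj_dualAct, h.proj_incl]

/-- A comodule whose localization is indecomposable is itself indecomposable, provided that `e`
kills none of its nonzero subcomodules. -/
theorem isIndecomposableComodule (h : IsLocalizedBy e he p i)
    (hN : IsIndecomposableComodule K (Localized e he) N)
    (htf : ∀ P : Submodule K M, IsSubcomodule K C P → (∀ x ∈ P, dualAct e M x = 0) → P = ⊥) :
    IsIndecomposableComodule K C M := by
  obtain ⟨hnt, hN⟩ := hN
  refine ⟨(Function.LeftInverse.injective h.proj_incl).nontrivial, fun P Q hP hQ hPQ => ?_⟩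
  have key : ∀ P : Submodule K M, IsSubcomodule K C P → P.map p = ⊥ → P = ⊥ := by
    intro P hP h0
    refine htf P hP fun x hx => ?_
    have : p x = 0 := (Submodule.mem_bot K).1 (h0 ▸ Submodule.mem_map_of_mem hx)
    rw [← h.incl_proj, this, map_zero]
  refine (hN (P.map p) (Q.map p) (hP.map_of_comp h.coact_proj) (hQ.map_of_comp h.coact_proj)
    ⟨?_, ?_⟩).imp (key P hP) (key Q hQ)
  · rw [Submodule.disjoint_def]
    rintro _ ⟨x, hx, rfl⟩ ⟨x', hx', hxx⟩
    have h1 : dualAct e M x = 0 := by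
      refine (Submodule.disjoint_def.1 hPQ.disjoint) _ (dualAct_mem e hP hx) ?_
      rw [← h.incl_proj, ← hxx, h.incl_proj]
      exact dualAct_mem e hQ hx'
    rw [← h.proj_dualAct, h1, map_zero]
  · rw [codisjoint_iff, ← Submodule.map_sup, hPQ.sup_eq_top, Submodule.map_top,
      LinearMap.range_eq_top]
    exact fun y => ⟨i y, h.proj_incl y⟩

end IsLocalizedBy

section Bimodule

variable (R : Type*) [CommRing R] [Algebra K R]
  (L : Type*) [AddCommGroup L] [Module K L] [Module R L] [IsScalarTower K R L]
  [RightComodule K C L] [IsBimodule K C R L]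

theorem dualAct_smul (r : R) (x : L) : dualAct e L (r • x) = r • dualAct e L x := by
  rw [dualAct_apply, dualAct_apply, IsBimodule.coact_smul]
  generalize coact K C L x = z
  induction z with
  | zero => simp
  | add a b ha hb => simp only [map_add, smul_add, ha, hb]
  | tmul a b =>
    simp only [TensorProduct.smul_tmul', LinearMap.lTensor_tmul, TensorProduct.rid_tmul]
    rw [smul_comm]

/-- The action of `e` on an `R`-`C`-bimodule, as an `R`-linear map. -/
def dualActLinear : L →ₗ[R] L where
  toFun := dualAct e L
  map_add' := map_add _
  map_smul' := dualAct_smul e R L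

/-- The localization `eL` of an `R`-`C`-bimodule. -/
abbrev LocalizedSpace : Type _ := LinearMap.range (dualActLinear e R L)

/-- The projection `L → eL`. -/
def localizedProj : L →ₗ[R] LocalizedSpace e R L :=
  (dualActLinear e R L).rangeRestrict

/-- The inclusion `eL ⊆ L`. -/
def localizedIncl : LocalizedSpace e R L →ₗ[R] L :=
  (LinearMap.range (dualActLinear e R L)).subtype

theorem localizedProj_dualAct (hi : IsIdempotentElem e) (x : L) :
    localizedProj e R L (dualAct e L x) = localizedProj e R L x :=
  Subtype.ext (dualAct_dualAct e hi x)

/-- The coaction `e x ↦ ∑ e x₀ ⊗ e x₁ e` of `eCe` on `eL`. -/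
def localizedCoact : LocalizedSpace e R L →ₗ[K] LocalizedSpace e R L ⊗[K] Localized e he :=
  TensorProduct.map ((localizedProj e R L).restrictScalars K) (Localized.proj e he) ∘ₗ
    coact K C L ∘ₗ (localizedIncl e R L).restrictScalars K

theorem localizedCoact_proj (x : L) : localizedCoact e he R L (localizedProj e R L x) =
    TensorProduct.map ((localizedProj e R L).restrictScalars K) (Localized.proj e he)
      (coact K C L x) := by
  change TensorProduct.map _ _ (coact K C L (dualAct e L x)) = _
  rw [coact_dualAct, LinearMap.lTensor, TensorProduct.map_map, Localized.proj_actL,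
    LinearMap.comp_id]

/-- The `eCe`-comodule structure on `eL`. -/
@[reducible]
def localizedComodule : RightComodule K (Localized e he) (LocalizedSpace e R L) :=
  inducedComodule (C := C) (Localized.proj e he) (Localized.comul_proj e he)
    ((localizedProj e R L).restrictScalars K)
    (LinearMap.surjective_rangeRestrict (dualActLinear e R L)) (localizedCoact e he R L)
    (LinearMap.ext (localizedCoact_proj e he R L)) (by
      intro x
      refine Eq.trans ?_ (localizedProj_dualAct e R L he x)
      have h : Coalgebra.counit (R := K) (A := Localized e he) ∘ₗ Localized.proj e he = e.ofConv :=
        Localized.counit_proj e he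
      rw [h, dualAct_apply]
      generalize coact K C L x = z
      induction z with
      | zero => simp
      | add a b ha hb => simp only [map_add, ha, hb]
      | tmul a b =>
        simp only [TensorProduct.map_tmul, LinearMap.lTensor_tmul, TensorProduct.rid_tmul]
        exact (map_smul ((localizedProj e R L).restrictScalars K) _ _).symm)

theorem isLocalizedBy_localizedComodule :
    letI := localizedComodule e he R L
    IsLocalizedBy e he ((localizedProj e R L).restrictScalars K)
      ((localizedIncl e R L).restrictScalars K) := by
  let _ := localizedComodule e he R L
  refine ⟨fun y => ?_, fun x => rfl, localizedCoact_proj e he R L⟩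
  obtain ⟨x, rfl⟩ := LinearMap.surjective_rangeRestrict (dualActLinear e R L) y
  exact localizedProj_dualAct e R L he x

theorem isBimodule_localizedComodule :
    letI := localizedComodule e he R L
    IsBimodule K (Localized e he) R (LocalizedSpace e R L) := by
  let _ := localizedComodule e he R L
  refine ⟨fun r y => ?_⟩
  change TensorProduct.map _ _ (coact K C L (r • y.1)) =
    r • TensorProduct.map _ _ (coact K C L y.1)
  rw [IsBimodule.coact_smul]
  generalize coact K C L y.1 = z
  induction z with
  | zero => simp
  | add a b ha hb => simp only [map_add, smul_add, ha, hb]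
  | tmul a b =>
    simp only [TensorProduct.smul_tmul', TensorProduct.map_tmul, LinearMap.restrictScalars_apply,
      map_smul]

variable (A : Type*) [AddCommGroup A] [Module K A] [Module R A] [IsScalarTower K R A]

/-- Localization commutes with the tensor product over `R`: `e(A ⊗ L) = A ⊗ eL`. -/
theorem IsLocalizedBy.tensor {L' : Type*} [AddCommGroup L'] [Module K L'] [Module R L']
    [IsScalarTower K R L'] [RightComodule K (Localized e he) L']
    [IsBimodule K (Localized e he) R L'] {p : L →ₗ[R] L'} {i : L' →ₗ[R] L}
    (h : IsLocalizedBy e he (p.restrictScalars K) (i.restrictScalars K)) :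
    IsLocalizedBy e he ((p.lTensor A).restrictScalars K : A ⊗[R] L →ₗ[K] A ⊗[R] L')
      ((i.lTensor A).restrictScalars K) := by
  refine ⟨fun y => ?_, fun x => ?_, fun x => ?_⟩
  · have : p ∘ₗ i = LinearMap.id := LinearMap.ext h.proj_incl
    simp only [LinearMap.restrictScalars_apply]
    rw [← LinearMap.lTensor_comp_apply, this, LinearMap.lTensor_id, LinearMap.id_apply]
  · simp only [LinearMap.restrictScalars_apply]
    induction x with
    | zero => simp
    | add a b ha hb => simp only [map_add, ha, hb]
    | tmul m l =>
      have h1 : coact K C (A ⊗[R] L) (m ⊗ₜ l) = _ := tensorCoact_tmul K C R A L m l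
      have h2 : i (p l) = _ := h.incl_proj l
      rw [dualAct_apply, h1, LinearMap.lTensor_tmul, LinearMap.lTensor_tmul, h2, dualAct_apply]
      generalize coact K C L l = z
      change tmulLeft K R A L m _ = _
      induction z with
      | zero => simp
      | add a b ha hb => simp only [map_add, ha, hb]
      | tmul a b => simp
  · simp only [LinearMap.restrictScalars_apply]
    induction x with
    | zero => simp
    | add a b ha hb => simp only [map_add, ha, hb]
    | tmul m l =>
      have h1 : coact K C (A ⊗[R] L) (m ⊗ₜ l) = _ := tensorCoact_tmul K C R A L m l
      have h2 : coact K (Localized e he) (A ⊗[R] L') (m ⊗ₜ p l) = _ :=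
        tensorCoact_tmul K (Localized e he) R A L' m (p l)
      have h3 : coact K (Localized e he) L' (p l) = _ := h.coact_proj l
      rw [h1, LinearMap.lTensor_tmul, h2, h3]
      generalize coact K C L l = z
      induction z with
      | zero => simp
      | add a b ha hb => simp only [map_add, ha, hb]
      | tmul a b => simp [tmulLeft]

end Bimodule

end LocalizationFunctor

/-! ### The section functor -/

section SectionFunctor

variable {K : Type*} {C : Type*} [Field K] [AddCommGroup C] [Module K C] [Coalgebra K C]
  (e : WithConv (C →ₗ[K] K)) (he : IsIdempotentElem e)

theorem RightPart.actR_incl (y : RightPart e he) :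
    actR e (RightPart.incl e he y) = RightPart.incl e he y := by
  obtain ⟨x, rfl⟩ := RightPart.proj_surjective e he y
  rw [RightPart.incl_proj, actR_actR e he]

/-- The inclusion `eCe ⊆ Ce`. -/
def Localized.toRightPart : Localized e he →ₗ[K] RightPart e he :=
  (Localized.incl e he).codRestrict (LinearMap.range (actR e)) (by
    intro y
    obtain ⟨x, rfl⟩ := Localized.proj_surjective e he y
    rw [Localized.incl_proj, actL_actR]
    exact ⟨_, rfl⟩)

theorem RightPart.incl_toRightPart (y : Localized e he) :
    RightPart.incl e he (Localized.toRightPart e he y) = Localized.incl e he y :=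
  rfl

theorem Localized.proj_incl (y : Localized e he) :
    Localized.proj e he (Localized.incl e he y) = y := by
  obtain ⟨x, rfl⟩ := Localized.proj_surjective e he y
  rw [Localized.incl_proj]
  have h1 := LinearMap.congr_fun (Localized.proj_actL e he) (actR e x)
  have h2 := LinearMap.congr_fun (Localized.proj_actR e he) x
  simp only [LinearMap.comp_apply] at h1 h2
  rw [h1, h2]

theorem RightPart.dualAct_eq (y : RightPart e he) :
    dualAct e (RightPart e he) y =
      Localized.toRightPart e he (Localized.proj e he (RightPart.incl e he y)) := by
  have h : ∀ z : C ⊗[K] C, TensorProduct.rid K (RightPart e he) (e.ofConv.lTensor _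
      ((RightPart.proj e he).rTensor C z)) =
      RightPart.proj e he (TensorProduct.rid K C (e.ofConv.lTensor C z)) := by
    intro z
    induction z with
    | zero => simp
    | add a b ha hb => simp only [map_add, ha, hb]
    | tmul a b => simp
  apply RightPart.incl_injective
  refine (congrArg (RightPart.incl e he) (h (comul (R := K) (RightPart.incl e he y)))).trans ?_
  rw [RightPart.incl_toRightPart, Localized.incl_proj, actL_actR]
  rfl

/-- The counit of `C`, restricted to `Ce`. -/
def RightPart.counit : RightPart e he →ₗ[K] K :=
  Coalgebra.counit ∘ₗ RightPart.incl e he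

theorem RightPart.rid_counit_coactL (y : RightPart e he) :
    TensorProduct.rid K (Localized e he) ((RightPart.counit e he).lTensor _
      (RightPart.coactL e he y)) = Localized.proj e he (RightPart.incl e he y) := by
  have h : ∀ z : C ⊗[K] C, TensorProduct.rid K (Localized e he) ((RightPart.counit e he).lTensor _
      (TensorProduct.map (Localized.proj e he) (RightPart.proj e he) z)) =
      Localized.proj e he (TensorProduct.rid K C (e.ofConv.lTensor C z)) := by
    intro z
    induction z with
    | zero => simp
    | add a b ha hb => simp only [map_add, ha, hb]
    | tmul a b => simp [RightPart.counit, RightPart.incl_proj, counit_actR]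
  have h2 := LinearMap.congr_fun (Localized.proj_actL e he) (RightPart.incl e he y)
  exact (h (comul (R := K) (RightPart.incl e he y))).trans h2

theorem RightPart.lid_counit_coactR (y : RightPart e he) :
    TensorProduct.lid K C ((RightPart.counit e he).rTensor C (RightPart.coactR e he y)) =
      RightPart.incl e he y := by
  have h : ∀ z : C ⊗[K] C, TensorProduct.lid K C ((RightPart.counit e he).rTensor C
      ((RightPart.proj e he).rTensor C z)) = TensorProduct.lid K C (e.ofConv.rTensor C z) := by
    intro z
    induction z with
    | zero => simp
    | add a b ha hb => simp only [map_add, ha, hb]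
    | tmul a b => simp [RightPart.counit, RightPart.incl_proj, counit_actR]
  exact (h (comul (R := K) (RightPart.incl e he y))).trans (RightPart.actR_incl e he y)

variable (N : Type*) [AddCommGroup N] [Module K N]

/-- The map `N ⊗ Ce → N`, `n ⊗ y ↦ ε(y) n`. -/
def counitProj : N ⊗[K] RightPart e he →ₗ[K] N :=
  (TensorProduct.rid K N).toLinearMap ∘ₗ (RightPart.counit e he).lTensor N

/-- The map `N ⊗ Ce → N ⊗ eCe`, `n ⊗ y ↦ n ⊗ e y`. -/
def idealProj : N ⊗[K] RightPart e he →ₗ[K] N ⊗[K] Localized e he :=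
  (Localized.proj e he ∘ₗ RightPart.incl e he).lTensor N

theorem coact_tensor_rightPart_tmul (n : N) (y : RightPart e he) :
    coact K C (N ⊗[K] RightPart e he) (n ⊗ₜ y) =
      (TensorProduct.mk K N _ n).rTensor C (RightPart.coactR e he y) :=
  tensorCoact_tmul K C K N (RightPart e he) n y

theorem dualAct_tensor_rightPart (x : N ⊗[K] RightPart e he) :
    dualAct e (N ⊗[K] RightPart e he) x =
      (Localized.toRightPart e he).lTensor N (idealProj e he N x) := by
  induction x with
  | zero => simp
  | add a b ha hb => simp only [map_add, ha, hb]
  | tmul n y =>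
    have h : ∀ z : RightPart e he ⊗[K] C, TensorProduct.rid K _ (e.ofConv.lTensor _
        ((TensorProduct.mk K N _ n).rTensor C z)) =
        n ⊗ₜ[K] TensorProduct.rid K _ (e.ofConv.lTensor _ z) := by
      intro z
      induction z with
      | zero => simp
      | add a b ha hb => simp only [map_add, TensorProduct.tmul_add, ha, hb]
      | tmul a b => simp
    rw [dualAct_apply, coact_tensor_rightPart_tmul, h]
    exact congrArg (fun t => n ⊗ₜ[K] t) (RightPart.dualAct_eq e he y)

theorem map_counitProj_coact (x : N ⊗[K] RightPart e he) :
    TensorProduct.map (counitProj e he N) (Localized.proj e he)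
      (coact K C (N ⊗[K] RightPart e he) x) = idealProj e he N x := by
  induction x with
  | zero => simp
  | add a b ha hb => simp only [map_add, ha, hb]
  | tmul n y =>
    have h : ∀ z : RightPart e he ⊗[K] C, TensorProduct.map (counitProj e he N)
        (Localized.proj e he) ((TensorProduct.mk K N _ n).rTensor C z) =
        n ⊗ₜ[K] Localized.proj e he (TensorProduct.lid K C
          ((RightPart.counit e he).rTensor C z)) := by
      intro z
      induction z with
      | zero => simp
      | add a b ha hb => simp only [map_add, TensorProduct.tmul_add, ha, hb]
      | tmul a b => simp [counitProj, TensorProduct.smul_tmul]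
    rw [coact_tensor_rightPart_tmul, h, RightPart.lid_counit_coactR]
    rfl

/-- An element `x = ∑ n ⊗ y` of `N ⊗ Ce` is recovered from its coaction as
`∑ n ⊗ e(y₁) y₂`, so the coaction is injective even after the action of `e` on its first
factor. -/
theorem eq_zero_of_dualAct_rTensor_coact (x : N ⊗[K] RightPart e he)
    (hx : (dualAct e (N ⊗[K] RightPart e he)).rTensor C
      (coact K C (N ⊗[K] RightPart e he) x) = 0) : x = 0 := by
  -- `n ⊗ y ↦ ε(y) n` is unchanged by precomposition with `e`, and applied to the first factor of
  -- the coaction it returns `x`, viewed in `N ⊗ C`.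
  let q : N ⊗[K] RightPart e he →ₗ[K] N := counitProj e he N
  have hq : ∀ y : RightPart e he, RightPart.counit e he (dualAct e _ y) =
      RightPart.counit e he y := by
    intro y
    rw [RightPart.dualAct_eq, RightPart.counit, LinearMap.comp_apply, LinearMap.comp_apply,
      RightPart.incl_toRightPart]
    have h1 := LinearMap.congr_fun (Localized.counit_proj e he) (RightPart.incl e he y)
    simp only [LinearMap.comp_apply] at h1
    rw [h1, ← counit_actR, RightPart.actR_incl]
  have hqe : q ∘ₗ dualAct e (N ⊗[K] RightPart e he) = q := by
    ext n y
    have h1 := dualAct_tensor_rightPart e he N (n ⊗ₜ y)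
    have h2 : (Localized.toRightPart e he).lTensor N (idealProj e he N (n ⊗ₜ y)) =
        n ⊗ₜ dualAct e _ y := by rw [RightPart.dualAct_eq]; rfl
    simp only [TensorProduct.AlgebraTensorModule.curry_apply, TensorProduct.curry_apply,
      LinearMap.comp_apply, LinearMap.restrictScalars_self]
    rw [h1, h2]
    simp [q, counitProj, hq]
  have hrec : ∀ x, q.rTensor C (coact K C (N ⊗[K] RightPart e he) x) =
      (RightPart.incl e he).lTensor N x := by
    intro x
    induction x with
    | zero => simp
    | add a b ha hb => simp only [map_add, ha, hb]
    | tmul n y =>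
      have h : ∀ z : RightPart e he ⊗[K] C, q.rTensor C ((TensorProduct.mk K N _ n).rTensor C z) =
          n ⊗ₜ[K] TensorProduct.lid K C ((RightPart.counit e he).rTensor C z) := by
        intro z
        induction z with
        | zero => simp
        | add a b ha hb => simp only [map_add, TensorProduct.tmul_add, ha, hb]
        | tmul a b => simp [q, counitProj, TensorProduct.smul_tmul]
      rw [coact_tensor_rightPart_tmul, h, RightPart.lid_counit_coactR, LinearMap.lTensor_tmul]
  apply Module.Flat.lTensor_preserves_injective_linearMap (M := N) _
    (RightPart.incl_injective e he)
  rw [map_zero, ← hrec, ← hqe, LinearMap.rTensor_comp_apply, hx, map_zero]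

/-- The idempotent `e` kills no nonzero subcomodule of `N ⊗ Ce`. -/
theorem eq_bot_of_dualAct_eq_zero {P : Submodule K (N ⊗[K] RightPart e he)}
    (hP : IsSubcomodule K C P)
    (h0 : ∀ x ∈ P, dualAct e (N ⊗[K] RightPart e he) x = 0) : P = ⊥ := by
  refine (Submodule.eq_bot_iff P).2 fun x hx => eq_zero_of_dualAct_rTensor_coact e he N x ?_
  obtain ⟨z, hz⟩ := hP x hx
  have : dualAct e (N ⊗[K] RightPart e he) ∘ₗ P.subtype = 0 := LinearMap.ext fun x => h0 x x.2
  rw [← hz, ← LinearMap.rTensor_comp_apply, this, LinearMap.rTensor_zero, LinearMap.zero_apply]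

variable [RightComodule K (Localized e he) N]

theorem isSubcomodule_sectionSpace : IsSubcomodule K C (SectionSpace e he N) :=
  isSubcomodule_eqLocus (cotensorLeft_isComoduleHom e he N) (cotensorRight_isComoduleHom e he N)

theorem isComoduleHom_sectionSpace_subtype : IsComoduleHom K C (SectionSpace e he N).subtype :=
  isComoduleHom_subtype (isSubcomodule_sectionSpace e he N)

/-- On the cotensor product, `∑ ε(y) ρ(n) = ∑ n ⊗ e y`: this is the defining equation of the
cotensor product, with the counit applied to the last factor. -/
theorem coact_counitProj {x : N ⊗[K] RightPart e he} (hx : x ∈ SectionSpace e he N) :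
    coact K (Localized e he) N (counitProj e he N x) = idealProj e he N x := by
  let F : N ⊗[K] (Localized e he ⊗[K] RightPart e he) →ₗ[K] N ⊗[K] Localized e he :=
    ((TensorProduct.rid K (Localized e he)).toLinearMap ∘ₗ
      (RightPart.counit e he).lTensor _).lTensor N
  have h1 : ∀ x, F (cotensorLeft e he N x) = coact K (Localized e he) N (counitProj e he N x) := by
    intro x
    induction x with
    | zero => simp
    | add a b ha hb => simp only [map_add, ha, hb]
    | tmul n y =>
      simp only [cotensorLeft, counitProj, LinearMap.comp_apply, LinearMap.rTensor_tmul,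
        LinearMap.lTensor_tmul, LinearEquiv.coe_coe, TensorProduct.rid_tmul, map_smul]
      generalize coact K (Localized e he) N n = z
      induction z with
      | zero => simp
      | add a b ha hb => simp only [map_add, TensorProduct.add_tmul, smul_add, ha, hb]
      | tmul a b => simp [F]
  have h2 : ∀ x, F (cotensorRight e he N x) = idealProj e he N x := by
    intro x
    rw [cotensorRight, ← LinearMap.lTensor_comp_apply, idealProj]
    congr 2
    exact LinearMap.ext (RightPart.rid_counit_coactL e he)
  rw [← h1, ← h2, show cotensorLeft e he N x = cotensorRight e he N x from hx]

theorem coactL_toRightPart (y : Localized e he) :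
    RightPart.coactL e he (Localized.toRightPart e he y) =
      (Localized.toRightPart e he).lTensor _ (comul (R := K) y) := by
  obtain ⟨x, rfl⟩ := Localized.proj_surjective e he y
  have hx := LinearMap.congr_fun (Localized.comul_proj e he) x
  have ht : Localized.toRightPart e he ∘ₗ Localized.proj e he = RightPart.proj e he ∘ₗ actL e := by
    apply LinearMap.ext
    intro y
    apply RightPart.incl_injective
    simp only [LinearMap.comp_apply]
    rw [RightPart.incl_toRightPart, Localized.incl_proj, RightPart.incl_proj, actL_actR]
  have hy := LinearMap.congr_fun (RightPart.coactL_proj e he) (actL e x)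
  have ht' := LinearMap.congr_fun ht x
  simp only [LinearMap.comp_apply] at hx hy ht'
  change _ = (Localized.toRightPart e he).lTensor _ (Localized.comul e he _)
  rw [hx, ht', hy, comul_actL, LinearMap.lTensor, LinearMap.lTensor, TensorProduct.map_map,
    TensorProduct.map_map, ht, LinearMap.comp_id, LinearMap.id_comp]

/-- The coaction of `N` takes values in the cotensor product. -/
theorem lTensor_coact_mem (n : N) :
    (Localized.toRightPart e he).lTensor N (coact K (Localized e he) N n) ∈
      SectionSpace e he N := by
  change cotensorLeft e he N _ = cotensorRight e he N _
  have h1 : ∀ z : N ⊗[K] Localized e he,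
      cotensorLeft e he N ((Localized.toRightPart e he).lTensor N z) =
      ((Localized.toRightPart e he).lTensor _).lTensor N
        (TensorProduct.assoc K _ _ _ ((coact K (Localized e he) N).rTensor _ z)) := by
    intro z
    induction z with
    | zero => simp
    | add a b ha hb => simp only [map_add, ha, hb]
    | tmul a b =>
      simp only [cotensorLeft, LinearMap.comp_apply, LinearMap.rTensor_tmul,
        LinearMap.lTensor_tmul, LinearEquiv.coe_coe]
      generalize coact K (Localized e he) N a = y
      induction y with
      | zero => simp
      | add c d hc hd => simp only [map_add, TensorProduct.add_tmul, hc, hd]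
      | tmul c d => simp
  have h2 : ∀ z : N ⊗[K] Localized e he,
      cotensorRight e he N ((Localized.toRightPart e he).lTensor N z) =
      ((Localized.toRightPart e he).lTensor _).lTensor N
        ((comul (R := K) (A := Localized e he)).lTensor N z) := by
    intro z
    rw [cotensorRight, ← LinearMap.lTensor_comp_apply, ← LinearMap.lTensor_comp_apply]
    congr 2
    exact LinearMap.ext (coactL_toRightPart e he)
  have h3 := LinearMap.congr_fun
    (RightComodule.coassoc (K := K) (C := Localized e he) (M := N)) n
  rw [h1, h2]
  exact congrArg _ h3

/-- `N` is the localization of `S(N)`: the section functor is a right inverse of the localization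
functor. -/
theorem isLocalizedBy_sectionSpace :
    IsLocalizedBy e he (counitProj e he N ∘ₗ (SectionSpace e he N).subtype)
      (((Localized.toRightPart e he).lTensor N ∘ₗ coact K (Localized e he) N).codRestrict
        (SectionSpace e he N) (lTensor_coact_mem e he N)) := by
  have hs := isComoduleHom_sectionSpace_subtype e he N
  refine ⟨fun n => ?_, fun x => Subtype.ext ?_, fun x => ?_⟩
  · refine Eq.trans ?_ (rid_lTensor_counit_coact (K := K) (C := Localized e he) n)
    change TensorProduct.rid K N ((RightPart.counit e he).lTensor N
      ((Localized.toRightPart e he).lTensor N _)) = _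
    rw [← LinearMap.lTensor_comp_apply]
    rfl
  · refine Eq.trans ?_ (hs.map_dualAct e x).symm
    rw [dualAct_tensor_rightPart]
    exact congrArg _ (coact_counitProj e he N x.2)
  · rw [LinearMap.comp_apply]
    refine (coact_counitProj e he N x.2).trans ?_
    rw [← map_counitProj_coact]
    change TensorProduct.map _ _ (coact K C _ ((SectionSpace e he N).subtype x)) = _
    rw [hs.apply, LinearMap.rTensor, TensorProduct.map_map, LinearMap.comp_id]

theorem isIndecomposableComodule_sectionSpace
    (hN : IsIndecomposableComodule K (Localized e he) N) :
    IsIndecomposableComodule K C (SectionSpace e he N) := by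
  have hs := isComoduleHom_sectionSpace_subtype e he N
  refine (isLocalizedBy_sectionSpace e he N).isIndecomposableComodule hN fun P hP h0 => ?_
  apply Submodule.map_injective_of_injective (SectionSpace e he N).injective_subtype
  rw [Submodule.map_bot]
  refine eq_bot_of_dualAct_eq_zero e he N (hP.map hs) ?_
  rintro _ ⟨x, hx, rfl⟩
  rw [← hs.map_dualAct, h0 x hx, map_zero]

end SectionFunctor

/-! ### Left exactness of the section functor -/

section SectionMap

variable {K : Type*} {C : Type*} [Field K] [AddCommGroup C] [Module K C] [Coalgebra K C]
  (e : WithConv (C →ₗ[K] K)) (he : IsIdempotentElem e)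
  {N : Type*} [AddCommGroup N] [Module K N] {N' : Type*} [AddCommGroup N'] [Module K N']
  {N'' : Type*} [AddCommGroup N''] [Module K N'']
  {f : N →ₗ[K] N'} {g : N' →ₗ[K] N''}

theorem cotensorRight_rTensor (f : N →ₗ[K] N') (x : N ⊗[K] RightPart e he) :
    cotensorRight e he N' (f.rTensor _ x) = f.rTensor _ (cotensorRight e he N x) := by
  induction x with
  | zero => simp
  | add a b ha hb => simp only [map_add, ha, hb]
  | tmul n y => simp [cotensorRight]

theorem isComoduleHom_rTensor_rightPart (f : N →ₗ[K] N') :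
    IsComoduleHom K C (f.rTensor (RightPart e he)) := by
  ext n y
  simp only [TensorProduct.AlgebraTensorModule.curry_apply, TensorProduct.curry_apply,
    LinearMap.comp_apply, LinearMap.restrictScalars_self, LinearMap.rTensor_tmul]
  rw [coact_tensor_rightPart_tmul, coact_tensor_rightPart_tmul, ← LinearMap.rTensor_comp_apply]
  rfl

variable [RightComodule K (Localized e he) N] [RightComodule K (Localized e he) N']
  [RightComodule K (Localized e he) N'']

theorem cotensorLeft_rTensor (hf : IsComoduleHom K (Localized e he) f)
    (x : N ⊗[K] RightPart e he) :
    cotensorLeft e he N' (f.rTensor _ x) = f.rTensor _ (cotensorLeft e he N x) := by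
  induction x with
  | zero => simp
  | add a b ha hb => simp only [map_add, ha, hb]
  | tmul n y =>
    simp only [cotensorLeft, LinearMap.comp_apply, LinearMap.rTensor_tmul, LinearEquiv.coe_coe]
    rw [hf.apply]
    generalize coact K (Localized e he) N n = z
    induction z with
    | zero => simp
    | add a b ha hb => simp only [map_add, TensorProduct.add_tmul, ha, hb]
    | tmul a b => simp

theorem rTensor_mem_sectionSpace (hf : IsComoduleHom K (Localized e he) f)
    {x : N ⊗[K] RightPart e he} (hx : x ∈ SectionSpace e he N) :
    f.rTensor _ x ∈ SectionSpace e he N' := by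
  change cotensorLeft e he N' _ = cotensorRight e he N' _
  rw [cotensorLeft_rTensor e he hf, cotensorRight_rTensor,
    show cotensorLeft e he N x = cotensorRight e he N x from hx]

/-- The section functor on homomorphisms. -/
def sectionMap (hf : IsComoduleHom K (Localized e he) f) :
    SectionSpace e he N →ₗ[K] SectionSpace e he N' :=
  (f.rTensor (RightPart e he)).restrict fun _ hx => rTensor_mem_sectionSpace e he hf hx

theorem subtype_comp_sectionMap (hf : IsComoduleHom K (Localized e he) f) :
    (SectionSpace e he N').subtype ∘ₗ sectionMap e he hf =
      f.rTensor (RightPart e he) ∘ₗ (SectionSpace e he N).subtype :=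
  rfl

theorem isComoduleHom_sectionMap (hf : IsComoduleHom K (Localized e he) f) :
    IsComoduleHom K C (sectionMap e he hf) :=
  IsComoduleHom.of_comp_injective (isComoduleHom_sectionSpace_subtype e he N')
    (Submodule.injective_subtype _) (by
      rw [subtype_comp_sectionMap]
      exact (isComoduleHom_rTensor_rightPart e he f).comp
        (isComoduleHom_sectionSpace_subtype e he N))

theorem sectionMap_injective (hf : IsComoduleHom K (Localized e he) f)
    (hi : Function.Injective f) : Function.Injective (sectionMap e he hf) := fun _ _ hxy =>
  Subtype.ext (Module.Flat.rTensor_preserves_injective_linearMap (M := RightPart e he) f hi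
    (congrArg Subtype.val hxy))

theorem sectionMap_exact (hf : IsComoduleHom K (Localized e he) f)
    (hg : IsComoduleHom K (Localized e he) g) (hi : Function.Injective f)
    (ex : Function.Exact f g) :
    Function.Exact (sectionMap e he hf) (sectionMap e he hg) := by
  have ex' := Module.Flat.rTensor_exact (RightPart e he) ex
  intro y
  constructor
  · intro hy
    obtain ⟨x, hx⟩ := (ex' y.1).1 (congrArg Subtype.val hy)
    refine ⟨⟨x, ?_⟩, Subtype.ext hx⟩
    apply Module.Flat.rTensor_preserves_injective_linearMap
      (M := Localized e he ⊗[K] RightPart e he) f hi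
    rw [← cotensorLeft_rTensor e he hf, ← cotensorRight_rTensor, hx]
    exact y.2
  · rintro ⟨x, rfl⟩
    exact Subtype.ext (ex'.apply_apply_eq_zero x.1)

end SectionMap

/-! ### Transfer of tame and discrete comodule type -/

section Transfer

variable {K C : Type u} [Field K] [AddCommGroup C] [Module K C] [Coalgebra K C]
  (e : WithConv (C →ₗ[K] K)) (he : IsIdempotentElem e)

/-- If `S` is finite-dimensional on simple comodules, it is finite-dimensional on all comodules with
a given length vector `v`, and the length vectors of its values there are bounded. -/
theorem exists_bound_lengthVector_section
    (hS : ∀ S : Comod.{u, u, u} K (Localized e he), IsSimpleComodule K (Localized e he) S.carrier →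
      FiniteDimensional K (sectionFunctor e he S).carrier)
    (v : GrothendieckGroup K (Localized e he)) :
    ∃ b : GrothendieckGroup K C, ∀ N : Comod.{u, u, u} K (Localized e he), HasLengthVector N v →
      FiniteDimensional K (sectionFunctor e he N).carrier ∧
        ∃ w ≤ b, HasLengthVector (sectionFunctor e he N) w := by
  have hβ : ∀ c : SimpleClass K (Localized e he), ∃ w : GrothendieckGroup K C,
      HasLengthVector (sectionFunctor e he (Quotient.out c).1) w := fun c =>
    have := hS _ (Quotient.out c).2
    exists_hasLengthVector _
  choose β hβ using hβ
  refine ⟨Finsupp.linearCombination ℤ β v, fun N hN => ?_⟩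
  induction hN with
  | zero N hN =>
    have : Subsingleton (sectionFunctor e he N).carrier :=
      inferInstanceAs (Subsingleton (SectionSpace e he N.carrier))
    exact ⟨inferInstance, 0, by simp, .zero _ this⟩
  | step N' N T hT f g hf hg fi gs ex v hN' ih =>
    obtain ⟨hfd, w, hw, hlv⟩ := ih
    -- The quotient `T` is replaced by the chosen representative `R` of its class.
    set c := SimpleClass.mk K (Localized e he) T hT with hc
    have hrel : (simpleSetoid K (Localized e he)).r ⟨T, hT⟩ (Quotient.out c) :=
      Setoid.symm' _ (Quotient.mk_out (s := simpleSetoid K (Localized e he)) ⟨T, hT⟩)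
    obtain ⟨φ, hφ⟩ := hrel
    have hg' := hφ.comp hg
    have ex' : Function.Exact f (φ.toLinearMap ∘ₗ g) := fun y => by
      rw [← ex y]
      simp
    have hSex := sectionMap_exact e he hf hg' fi ex'
    constructor
    · have h1 : FiniteDimensional K (SectionSpace e he N'.carrier) := hfd
      have h2 : FiniteDimensional K (SectionSpace e he (Quotient.out c).1.carrier) :=
        hS _ (Quotient.out c).2
      have h : IsNoetherian K (SectionSpace e he N.carrier) :=
        isNoetherian_of_range_eq_ker (sectionMap e he hf) (sectionMap e he hg')
          hSex.linearMap_ker_eq.symm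
      exact inferInstanceAs (FiniteDimensional K (SectionSpace e he N.carrier))
    · obtain ⟨w', hw', h⟩ := (hβ c).exists_le_add_of_exact hlv (sectionFunctor e he N)
        (sectionMap e he hf) (isComoduleHom_sectionMap e he hf) (sectionMap_injective e he hf fi)
        (sectionMap e he hg') (isComoduleHom_sectionMap e he hg') hSex
      refine ⟨w', hw'.trans ?_, h⟩
      rw [map_add, Finsupp.linearCombination_single, one_smul, add_comm]
      gcongr

/-- The localization of a comodule, as a bundled comodule. -/
def Comod.localized (M : Comod.{u, u, u} K C) : Comod.{u, u, u} K (Localized e he) :=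
  letI := localizedComodule e he K M.carrier
  ⟨LocalizedSpace e K M.carrier⟩

/-- The localization of a `K[t]`-`C`-bimodule, as a bundled bimodule. -/
def PolyBimodule.localized (L : PolyBimodule.{u, u, u} K C) :
    PolyBimodule.{u, u, u} K (Localized e he) :=
  letI := localizedComodule e he K[X] L.carrier
  haveI := isBimodule_localizedComodule e he K[X] L.carrier
  ⟨LocalizedSpace e K[X] L.carrier⟩

theorem PolyBimodule.localized_finite_free (L : PolyBimodule.{u, u, u} K C)
    [Module.Finite K[X] L.carrier] [Module.Free K[X] L.carrier] :
    Module.Finite K[X] (L.localized e he).carrier ∧ Module.Free K[X] (L.localized e he).carrier :=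
  ⟨inferInstanceAs (Module.Finite K[X] (LinearMap.range (dualActLinear e K[X] L.carrier))),
    inferInstanceAs (Module.Free K[X] (LinearMap.range (dualActLinear e K[X] L.carrier)))⟩

theorem ComoduleIso.localized {N : Comod.{u, u, u} K (Localized e he)} {M : Comod.{u, u, u} K C}
    (h : ComoduleIso K C (sectionFunctor e he N).carrier M.carrier) :
    ComoduleIso K (Localized e he) N.carrier (M.localized e he).carrier :=
  (isLocalizedBy_sectionSpace e he N.carrier).comoduleIso
    (N' := (M.localized e he).carrier) (isLocalizedBy_localizedComodule e he K M.carrier) h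

theorem ComoduleIso.localized_pointModule {N : Comod.{u, u, u} K (Localized e he)}
    {L : PolyBimodule.{u, u, u} K C} {a : K}
    (h : ComoduleIso K C (sectionFunctor e he N).carrier (pointModule K a ⊗[K[X]] L.carrier)) :
    ComoduleIso K (Localized e he) N.carrier
      (pointModule K a ⊗[K[X]] (L.localized e he).carrier) := by
  let p : L.carrier →ₗ[K[X]] (L.localized e he).carrier := localizedProj e K[X] L.carrier
  let i : (L.localized e he).carrier →ₗ[K[X]] L.carrier := localizedIncl e K[X] L.carrier
  have hpi : IsLocalizedBy e he (p.restrictScalars K) (i.restrictScalars K) :=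
    isLocalizedBy_localizedComodule e he K[X] L.carrier
  exact (isLocalizedBy_sectionSpace e he N.carrier).comoduleIso
    (hpi.tensor e he K[X] L.carrier (pointModule K a)) h

/-- `TameWith`, with arbitrary finite index types in place of `Fin`. -/
theorem TameWith.of_fintype {v : GrothendieckGroup K C} {ι κ : Type*} [Fintype ι] [Fintype κ]
    (L : ι → PolyBimodule.{u, u, u} K C)
    (hL : ∀ s, Module.Finite K[X] (L s).carrier ∧ Module.Free K[X] (L s).carrier)
    (E : κ → Comod.{u, u, u} K C)
    (h : ∀ M : Comod.{u, u, u} K C, FiniteDimensional K M.carrier →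
      IsIndecomposableComodule K C M.carrier → HasLengthVector M v →
      (∃ j, ComoduleIso K C M.carrier (E j).carrier) ∨
      ∃ (s : ι) (a : K), ComoduleIso K C M.carrier (pointModule K a ⊗[K[X]] (L s).carrier)) :
    TameWith K C v (Fintype.card ι) := by
  let φ := Fintype.equivFin ι
  let ψ := Fintype.equivFin κ
  refine ⟨L ∘ φ.symm, fun s => hL _, _, E ∘ ψ.symm, fun M h1 h2 h3 => ?_⟩
  refine (h M h1 h2 h3).imp ?_ ?_
  · rintro ⟨j, hj⟩
    obtain ⟨j, rfl⟩ := ψ.symm.surjective j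
    exact ⟨j, hj⟩
  · rintro ⟨s, a, hs⟩
    obtain ⟨s, rfl⟩ := φ.symm.surjective s
    exact ⟨s, a, hs⟩

/-- If `r w` bimodules suffice for each length vector `w` of `C`, then for a length vector `v` of
`eCe` it is enough to take `r w` bimodules for each `w` in a suitable finite set. -/
theorem exists_tameWith_localized
    (hS : ∀ S : Comod.{u, u, u} K (Localized e he), IsSimpleComodule K (Localized e he) S.carrier →
      FiniteDimensional K (sectionFunctor e he S).carrier)
    {r : GrothendieckGroup K C → ℕ} (hr : ∀ w, TameWith K C w (r w))
    (v : GrothendieckGroup K (Localized e he)) :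
    ∃ W : Finset (GrothendieckGroup K C), TameWith K (Localized e he) v (∑ w ∈ W, r w) := by
  classical
  obtain ⟨b, hb⟩ := exists_bound_lengthVector_section e he hS v
  choose L hL n E hE using hr
  refine ⟨Finset.Icc 0 b, ?_⟩
  have hcard : ∑ w ∈ Finset.Icc 0 b, r w = Fintype.card (Σ w : Finset.Icc 0 b, Fin (r w)) := by
    rw [Fintype.card_sigma, ← Finset.sum_coe_sort]
    simp
  rw [hcard]
  refine TameWith.of_fintype (κ := Σ w : Finset.Icc 0 b, Fin (n w))
    (fun s => (L s.1 s.2).localized e he) (fun s => ?_) (fun j => (E j.1 j.2).localized e he)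
    fun N _ hN hv => ?_
  · obtain ⟨_, _⟩ := hL s.1 s.2
    exact (L s.1 s.2).localized_finite_free e he
  · obtain ⟨hfd, w, hw, hlv⟩ := hb N hv
    have hmem : w ∈ Finset.Icc 0 b := Finset.mem_Icc.2 ⟨hlv.nonneg, hw⟩
    refine (hE w _ hfd (isIndecomposableComodule_sectionSpace e he N.carrier hN) hlv).imp ?_ ?_
    · rintro ⟨j, hj⟩
      exact ⟨⟨⟨w, hmem⟩, j⟩, hj.localized e he⟩
    · rintro ⟨s, a, hs⟩
      exact ⟨⟨⟨w, hmem⟩, s⟩, a, hs.localized_pointModule e he⟩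

theorem IsTame.tameWith_growth (h : IsTame K C) (v : GrothendieckGroup K C) :
    TameWith K C v (growth K C v) :=
  Nat.sInf_mem (h v)

end Transfer

end CoalgLoc

end

theorem mainTheorem3 {K C : Type u} [Field K] [IsAlgClosed K] [AddCommGroup C] [Module K C]
    [Coalgebra K C] (e : WithConv (C →ₗ[K] K)) (he : IsIdempotentElem e)
    (hS : ∀ S : CoalgLoc.Comod.{u, u, u} K (CoalgLoc.Localized e he),
      CoalgLoc.IsSimpleComodule K (CoalgLoc.Localized e he) S.carrier →
        FiniteDimensional K (CoalgLoc.sectionFunctor e he S).carrier) :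
    (CoalgLoc.IsTame K C → CoalgLoc.IsTame K (CoalgLoc.Localized e he)) ∧
    (CoalgLoc.IsDiscrete K C → CoalgLoc.IsDiscrete K (CoalgLoc.Localized e he)) := by
  have key : CoalgLoc.IsTame K C → CoalgLoc.IsTame K (CoalgLoc.Localized e he) := fun h v =>
    have ⟨_, hW⟩ := CoalgLoc.exists_tameWith_localized e he hS h.tameWith_growth v
    ⟨_, hW⟩
  refine ⟨key, fun h => ⟨key h.1, fun v => Nat.sInf_eq_zero.2 (Or.inl ?_)⟩⟩
  obtain ⟨W, hW⟩ := CoalgLoc.exists_tameWith_localized e he hS h.1.tameWith_growth v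
  rwa [Finset.sum_eq_zero fun w _ => h.2 w] at hW
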